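/- Let $k$ be an algebraically closed field and let $A$ be a finite-dimensional indecomposable $k$-algebra (that is, $A\neq 0$ and $A$ is not isomorphic to a product of two nonzero $k$-algebras). Let $D^b(A)$ be the bounded derived category of the category of finite-dimensional left $A$-modules. A distinguished triangle $X\to Y\xrightarrow{v} Z\xrightarrow{w} X[1]$ in $D^b(A)$ is an Auslander-Reiten triangle, with middle term $Y$, if $X$ and $Z$ are indecomposable, $w\neq 0$, and every morphism $f:W\to Z$ in $D^b(A)$ that is not a retraction (split epimorphism) factors through $v$. The Auslander-Reiten quiver of $D^b(A)$ has as vertices the isomorphism classes of indecomposable objects, and it has $\dim_k \mathrm{Irr}(X,Y)$ arrows from $X$ to $Y$, where $\mathrm{Irr}(X,Y)=\mathrm{rad}(X,Y)/\mathrm{rad}^2(X,Y)$; here $\mathrm{rad}(X,Y)$ is the space of morphisms $f:X\to Y$ such that $\mathrm{id}_X-gf$ is invertible for all $g:Y\to X$, and $\mathrm{rad}^2(X,Y)$ is the span of the composites of two such radical morphisms $X\to Z\to Y$ through arbitrary objects $Z$. Its connected components are called Auslander-Reiten components. A component is stable if each of its vertices appears both at the start of an Auslander-Reiten triangle and at the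 end of an Auslander-Reiten triangle. Let $A_1$ denote the quiver with one vertex and no arrows. The following are equivalent: 1. There is a stable Auslander-Reiten component of $D^b(A)$ isomorphic to $A_1$. 2. $D^b(A)$ has an Auslander-Reiten triangle with middle term zero. 3. The algebra $A$ is simple. 4. The Auslander-Reiten quiver of $D^b(A)$ is the disjoint union of infinitely many components, each isomorphic to $A_1$. -/

import Mathlib

open CategoryTheory CategoryTheory.Limits CategoryTheory.Pretriangulated

universe u v w

namespace ARTheory

/-- A `k`-algebra is indecomposable if it is nonzero and it is not isomorphic to a product of two
nonzero `k`-algebras. -/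
def IsIndecomposableAlgebra (k : Type u) (A : Type v) [Field k] [Ring A] [Algebra k A] : Prop :=
  Nontrivial A ∧ ∀ (B C : Type v) [Ring B] [Ring C] [Algebra k B] [Algebra k C],
    Nonempty (A ≃ₐ[k] B × C) → Subsingleton B ∨ Subsingleton C

section Quivers

/-- The quiver `A₁`: one vertex and no arrows. -/
inductive QuiverA1 : Type
  | vertex

instance : Quiver.{0} QuiverA1 := ⟨fun _ _ => Empty⟩

/-- An isomorphism of quivers: a bijection on vertices together with bijections between the
sets of arrows. -/
structure QuiverIso (V : Type*) (W : Type*) [Quiver V] [Quiver W] where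
  vertexEquiv : V ≃ W
  arrowEquiv : ∀ x y : V, (x ⟶ y) ≃ (vertexEquiv x ⟶ vertexEquiv y)

/-- The vertices of a connected component `Λ` of a quiver. -/
def ComponentVertex {V : Type*} [Quiver V] (Λ : Quiver.WeaklyConnectedComponent V) : Type _ :=
  {x : V // (x : Quiver.WeaklyConnectedComponent V) = Λ}

/-- A connected component of a quiver is regarded as a full subquiver. -/
instance {V : Type*} [Quiver V] (Λ : Quiver.WeaklyConnectedComponent V) :
    Quiver (ComponentVertex Λ) := ⟨fun x y => x.1 ⟶ y.1⟩

end Quivers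

section Radical

variable (k : Type u) [Field k] {T : Type v} [Category.{w} T] [Preadditive T] [Linear k T]

/-- If `1 - f g` is invertible, so is `1 - g f`. -/
theorem isIso_id_sub_comp_swap {X Y : T} (f : X ⟶ Y) (g : Y ⟶ X) (h : IsIso (𝟙 X - f ≫ g)) :
    IsIso (𝟙 Y - g ≫ f) := by
  have h1 : (𝟙 X - f ≫ g) ≫ inv (𝟙 X - f ≫ g) = 𝟙 X := IsIso.hom_inv_id _
  have h2 : inv (𝟙 X - f ≫ g) ≫ (𝟙 X - f ≫ g) = 𝟙 X := IsIso.inv_hom_id _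
  generalize inv (𝟙 X - f ≫ g) = i at h1 h2
  have h1' : f ≫ g ≫ i = i - 𝟙 X := by
    rw [← h1]; simp
  have h2' : i ≫ f ≫ g = i - 𝟙 X := by
    rw [← h2]; simp
  refine ⟨𝟙 Y + g ≫ i ≫ f, ?_, ?_⟩
  · have := congrArg (fun z => g ≫ z ≫ f) h1'
    simp only [Category.assoc, Preadditive.sub_comp, Preadditive.comp_sub, Category.id_comp] at this
    simp [this]
  · have := congrArg (fun z => g ≫ z ≫ f) h2'
    simp only [Category.assoc, Preadditive.sub_comp, Preadditive.comp_sub, Category.id_comp] at this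
    simp [this]

/-- The (Jacobson) radical of a `k`-linear category: `f : X ⟶ Y` lies in `rad(X, Y)` if
`1 - g f` is invertible for all `g : Y ⟶ X`. For `X`, `Y` with local endomorphism rings
these are exactly the non-isomorphisms. -/
def radical (X Y : T) : Submodule k (X ⟶ Y) where
  carrier := {f | ∀ g : Y ⟶ X, IsIso (𝟙 X - f ≫ g)}
  zero_mem' g := by
    simp only [zero_comp, sub_zero]; infer_instance
  add_mem' {a b} ha hb g := by
    have := ha g
    have h : 𝟙 X - (a + b) ≫ g
        = (𝟙 X - a ≫ g) ≫ (𝟙 X - inv (𝟙 X - a ≫ g) ≫ b ≫ g) := by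
      simp [Preadditive.comp_sub, sub_sub]
    have h3 : IsIso (𝟙 X - inv (𝟙 X - a ≫ g) ≫ b ≫ g) := by
      apply isIso_id_sub_comp_swap
      rw [Category.assoc]
      exact hb _
    have h4 : IsIso ((𝟙 X - a ≫ g) ≫ (𝟙 X - inv (𝟙 X - a ≫ g) ≫ b ≫ g)) := inferInstance
    rw [h]
    exact h4
  smul_mem' c f hf g := by
    have := hf (c • g)
    rwa [Linear.comp_smul, ← Linear.smul_comp] at this

/-- The square of the radical: sums of composites `X ⟶ Z ⟶ Y` of two radical morphisms. -/
def radicalSq (X Y : T) : Submodule k (X ⟶ Y) :=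
  Submodule.span k {h | ∃ (Z : T) (f : X ⟶ Z) (g : Z ⟶ Y),
    f ∈ radical k X Z ∧ g ∈ radical k Z Y ∧ f ≫ g = h}

/-- The space of irreducible morphisms `Irr(X, Y) = rad(X, Y) / rad²(X, Y)`. -/
abbrev Irr (X Y : T) : Type w :=
  radical k X Y ⧸ (radicalSq k X Y).submoduleOf (radical k X Y)

end Radical

section AuslanderReiten

variable (k : Type u) [Field k] (T : Type v) [Category.{w} T] [Preadditive T] [Linear k T]
  [HasZeroObject T] [HasShift T ℤ] [∀ n : ℤ, (shiftFunctor T n).Additive] [Pretriangulated T]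

/-- Auslander-Reiten triangles `X ⟶ Y ⟶ Z ⟶ X⟦1⟧` in a triangulated category. -/
structure IsAuslanderReitenTriangle {T : Type v} [Category.{w} T] [Preadditive T]
    [HasZeroObject T] [HasShift T ℤ] [∀ n : ℤ, (shiftFunctor T n).Additive] [Pretriangulated T]
    (D : Triangle T) : Prop where
  distinguished : D ∈ distTriang T
  indecomposable₁ : Indecomposable D.obj₁
  indecomposable₃ : Indecomposable D.obj₃
  mor₃_ne_zero : D.mor₃ ≠ 0
  lift : ∀ (W : T) (f : W ⟶ D.obj₃), ¬ IsSplitEpi f → ∃ f' : W ⟶ D.obj₂, f' ≫ D.mor₂ = f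

/-- Isomorphism of indecomposable objects. -/
def indecomposableSetoid : Setoid {X : T // Indecomposable X} where
  r X Y := Nonempty (X.1 ≅ Y.1)
  iseqv := ⟨fun _ => ⟨Iso.refl _⟩, fun ⟨e⟩ => ⟨e.symm⟩, fun ⟨e⟩ ⟨e'⟩ => ⟨e ≪≫ e'⟩⟩

/-- The vertices of the Auslander-Reiten quiver: isomorphism classes of indecomposable objects. -/
def ARQuiver (_k : Type u) (T : Type v) [Category.{w} T] [Preadditive T]
    [HasZeroObject T] [HasShift T ℤ] [∀ n : ℤ, (shiftFunctor T n).Additive]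
    [Pretriangulated T] : Type v :=
  Quotient (indecomposableSetoid T)

/-- The number of arrows from the class of `X` to the class of `Y` is `dim_k Irr(X, Y)`: arrows
are indexed by a basis of this space (for chosen representatives of the two classes). -/
noncomputable instance : Quiver.{w} (ARQuiver k T) :=
  ⟨fun x y => Module.Free.ChooseBasisIndex k (Irr k (Quotient.out x).1 (Quotient.out y).1)⟩

/-- The Auslander-Reiten components: the connected components of the Auslander-Reiten quiver. -/
abbrev ARComponent : Type v := Quiver.WeaklyConnectedComponent (ARQuiver k T)

variable {T}

/-- The Auslander-Reiten component of an indecomposable object. -/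
noncomputable def componentOf (X : T) (hX : Indecomposable X) : ARComponent k T :=
  Quiver.WeaklyConnectedComponent.mk
    (Quotient.mk (indecomposableSetoid T) ⟨X, hX⟩ : ARQuiver k T)

variable {k}

/-- An Auslander-Reiten component is stable if each of its vertices appears at the start of an
Auslander-Reiten triangle and at the end of an Auslander-Reiten triangle. -/
def ARComponent.IsStable (Λ : ARComponent k T) : Prop :=
  ∀ (X : T) (hX : Indecomposable X), componentOf k X hX = Λ →
    (∃ D : Triangle T, IsAuslanderReitenTriangle D ∧ Nonempty (D.obj₁ ≅ X)) ∧
    (∃ D : Triangle T, IsAuslanderReitenTriangle D ∧ Nonempty (D.obj₃ ≅ X))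

/-- The component is isomorphic to `A₁`. -/
def ARComponent.IsA1 (Λ : ARComponent k T) : Prop :=
  Nonempty (QuiverIso (ComponentVertex Λ) QuiverA1)

end AuslanderReiten

end ARTheory

/-! Call a nonzero object a split sink if every nonzero morphism into it is a retraction. Each of
the four conditions amounts to the existence of a split sink in `D^b(A)`.

If a right almost split `v : Y ⟶ Z` with `Z` nonzero vanishes, then `Z` is a split sink; this
settles condition 2. If `Z` lies in a component `A₁`, then `rad(X, Z) = rad²(X, Z)` for `X`
indecomposable, hence for all `X`, since objects are finite sums of indecomposables. So `v` lies in
`rad²`, which forces `v = r ≫ v` with `r ∈ rad(Y, Y)` and thus `v = 0`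
(`IsRightAlmostSplit.eq_zero`). In condition 1 stability supplies such a `v`. For condition 4 one is
built as the cocone of a nonzero `w : P ⟶ I`, with `P` projective and `I` injective, that kills
every proper submodule of `P` (`exists_isRightAlmostSplit`).

A split sink receives a nonzero morphism from `A` placed in some degree, so it is a summand of it: a
module `M` in that degree, which is simple, projective and injective
(`IsSplitSink.exists_of_generator`). The sum of the left ideals isomorphic to `M` is a two-sided
ideal with a two-sided complement. Indecomposability makes it all of `A`, so `A` is simple
(`isSimpleRing_of_simple_projective_injective`).

Conversely, over a simple algebra finitely generated modules are projective and injective, with a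
single simple module `S` up to isomorphism. The indecomposables are the copies of `S` in the various
degrees. They are split sinks, so radical morphisms between them vanish, and `X ⟶ 0 ⟶ X⟦1⟧` are
Auslander-Reiten triangles. -/

namespace ARTheory

/-! ### The radical and its square as ideals -/

section Radical

variable (k : Type u) [Field k] {T : Type v} [Category.{w} T] [Preadditive T] [Linear k T]

theorem comp_mem_radical_left {W X Y : T} (h : W ⟶ X) {f : X ⟶ Y} (hf : f ∈ radical k X Y) :
    h ≫ f ∈ radical k W Y := fun g => by
  rw [Category.assoc]
  refine isIso_id_sub_comp_swap (f ≫ g) h ?_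
  rw [Category.assoc]
  exact hf _

theorem comp_mem_radical_right {X Y Z : T} {f : X ⟶ Y} (hf : f ∈ radical k X Y) (g : Y ⟶ Z) :
    f ≫ g ∈ radical k X Z := fun h => by
  rw [Category.assoc]
  exact hf _

theorem comp_mem_radicalSq {W X Y Z : T} (a : W ⟶ X) {f : X ⟶ Y} (hf : f ∈ radicalSq k X Y)
    (b : Y ⟶ Z) : a ≫ f ≫ b ∈ radicalSq k W Z := by
  have key : radicalSq k X Y ≤
      (radicalSq k W Z).comap (Linear.leftComp k Z a ∘ₗ Linear.rightComp k X b) := by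
    refine Submodule.span_le.2 ?_
    rintro _ ⟨V, p, q, hp, hq, rfl⟩
    refine Submodule.subset_span ⟨V, a ≫ p, q ≫ b, comp_mem_radical_left k a hp,
      comp_mem_radical_right k hq b, by simp⟩
  exact key hf

/-- Arrows are counted on representatives picked by `Quotient.out`; this passes to arbitrary objects
of the same classes. -/
theorem radical_le_radicalSq_of_iso {X Y X' Y' : T} (e : X' ≅ X) (e' : Y' ≅ Y)
    (h : radical k X' Y' ≤ radicalSq k X' Y') : radical k X Y ≤ radicalSq k X Y := fun f hf => by
  have h1 := h (comp_mem_radical_right k (comp_mem_radical_left k e.hom hf) e'.inv)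
  simpa using comp_mem_radicalSq k e.inv h1 e'.hom

theorem not_isSplitEpi_of_mem_radical {W Z : T} (hZ : ¬ IsZero Z) {f : W ⟶ Z}
    (hf : f ∈ radical k W Z) : ¬ IsSplitEpi f := fun h => hZ <| by
  have h1 := isIso_id_sub_comp_swap f (section_ f) (hf _)
  rw [IsSplitEpi.id, sub_self] at h1
  rw [IsZero.iff_id_eq_zero, ← IsIso.hom_inv_id (0 : Z ⟶ Z), zero_comp]

end Radical

/-! ### Right almost split morphisms and split sinks -/

section RightAlmostSplit

variable {T : Type v} [Category.{w} T]

/-- A morphism `v : Y ⟶ Z` is right almost split if it is not a retraction and if every morphism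
to `Z` which is not a retraction factors through `v`. -/
def IsRightAlmostSplit {Y Z : T} (v : Y ⟶ Z) : Prop :=
  ¬ IsSplitEpi v ∧ ∀ (W : T) (f : W ⟶ Z), ¬ IsSplitEpi f → ∃ f', f' ≫ v = f

/-- A nonzero object `Z` such that all nonzero morphisms to `Z` are retractions. -/
def IsSplitSink [HasZeroMorphisms T] (Z : T) : Prop :=
  ¬ IsZero Z ∧ ∀ (W : T) (f : W ⟶ Z), f ≠ 0 → IsSplitEpi f

theorem IsRightAlmostSplit.isSplitSink [HasZeroMorphisms T] {Y Z : T} {v : Y ⟶ Z}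
    (hv : IsRightAlmostSplit v) (hZ : ¬ IsZero Z) (h0 : v = 0) : IsSplitSink Z := by
  refine ⟨hZ, fun W f hf => ?_⟩
  by_contra h
  obtain ⟨f', rfl⟩ := hv.2 W f h
  exact hf (by rw [h0, comp_zero])

theorem IsSplitSink.of_iso [HasZeroMorphisms T] {Z Z' : T} (h : IsSplitSink Z) (e : Z ≅ Z') :
    IsSplitSink Z' := by
  refine ⟨fun h' => h.1 (h'.of_iso e), fun W f hf => ?_⟩
  have := h.2 W (f ≫ e.inv) fun h0 => hf (by simpa using congrArg (· ≫ e.hom) h0)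
  exact IsSplitEpi.mk' ⟨e.inv ≫ section_ (f ≫ e.inv), by
    have := IsSplitEpi.id (f ≫ e.inv)
    rw [Category.assoc, ← cancel_mono e.inv, Category.assoc, Category.assoc, this]
    simp⟩

/-- In a composite `p ≫ q` of radical morphisms, `q` is not a retraction, so `q = q' ≫ v` with `p ≫
q'` radical. Summing, `v = r ≫ v` with `r` radical, and `𝟙 Y - r` is invertible. -/
theorem IsRightAlmostSplit.eq_zero_of_mem_radicalSq (k : Type u) [Field k] [Preadditive T]
    [Linear k T] {Y Z : T} {v : Y ⟶ Z} (hv : IsRightAlmostSplit v) (hZ : ¬ IsZero Z)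
    (h : v ∈ radicalSq k Y Z) : v = 0 := by
  have key : radicalSq k Y Z ≤ (radical k Y Y).map (Linear.rightComp k Y v) := by
    refine Submodule.span_le.2 ?_
    rintro _ ⟨V, p, q, hp, hq, rfl⟩
    obtain ⟨q', rfl⟩ := hv.2 V q (not_isSplitEpi_of_mem_radical k hZ hq)
    exact ⟨p ≫ q', comp_mem_radical_right k hp q', by simp⟩
  obtain ⟨r, hr, hrv⟩ := key h
  have h1 : IsIso (𝟙 Y - r) := by simpa using hr (𝟙 Y)
  rw [← cancel_epi (𝟙 Y - r), comp_zero, Preadditive.sub_comp, Category.id_comp, sub_eq_zero]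
  exact hrv.symm

end RightAlmostSplit

/-! ### Right almost split morphisms in triangulated categories -/

section Triangulated

variable (k : Type u) [Field k] {T : Type v} [Category.{w} T] [Preadditive T] [Linear k T]
  [HasZeroObject T] [HasShift T ℤ] [∀ n : ℤ, (shiftFunctor T n).Additive] [Pretriangulated T]

/-- The triangle on a retraction splits, so `W` is the sum of `Z` and the cocone, which must vanish.
-/
theorem isIso_of_isSplitEpi {W Z : T} (hW : Indecomposable W) (hZ : ¬ IsZero Z) (f : W ⟶ Z)
    [IsSplitEpi f] : IsIso f := by
  obtain ⟨K, g, h, hT⟩ := distinguished_cocone_triangle₁ f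
  have h0 : h = 0 := by
    rw [← cancel_epi f, comp_zero]
    exact comp_distTriang_mor_zero₂₃ _ hT
  obtain ⟨e, -, -⟩ := exists_iso_binaryBiproduct_of_distTriang _ hT h0
  have hK : IsZero K := (hW.2 _ _ e).resolve_right hZ
  have : Mono f := Triangle.mono₂ _ hT (hK.eq_of_src _ _)
  exact isIso_of_mono_of_isSplitEpi f

/-- If neither `g ≫ f` nor `𝟙 Z - g ≫ f` were a retraction, both would factor through `v`, and so
would their sum `𝟙 Z`. Thus the second is a retraction, hence invertible as `Z` is indecomposable.
-/
theorem IsRightAlmostSplit.mem_radical {Y Z : T} {v : Y ⟶ Z} (hv : IsRightAlmostSplit v)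
    (hZ : Indecomposable Z) {W : T} (f : W ⟶ Z) (hf : ¬ IsSplitEpi f) : f ∈ radical k W Z := by
  intro g
  apply isIso_id_sub_comp_swap
  have h1 : ¬ IsSplitEpi (g ≫ f) := fun h => hf (IsSplitEpi.mk' ⟨section_ (g ≫ f) ≫ g, by
    rw [Category.assoc, IsSplitEpi.id]⟩)
  obtain ⟨a, ha⟩ := hv.2 _ _ h1
  have h2 : IsSplitEpi (𝟙 Z - g ≫ f) := by
    by_contra h
    obtain ⟨b, hb⟩ := hv.2 _ _ h
    exact hv.1 (IsSplitEpi.mk' ⟨a + b, by rw [Preadditive.add_comp, ha, hb]; abel⟩)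
  exact isIso_of_isSplitEpi hZ hZ.1 _

/-- A right almost split morphism to an indecomposable object vanishes if it is not detected
by irreducible morphisms. -/
theorem IsRightAlmostSplit.eq_zero {Y Z : T} {v : Y ⟶ Z} (hv : IsRightAlmostSplit v)
    (hZ : Indecomposable Z) (h : radical k Y Z ≤ radicalSq k Y Z) : v = 0 :=
  hv.eq_zero_of_mem_radicalSq k hZ.1 (h (hv.mem_radical k hZ v hv.1))

theorem IsAuslanderReitenTriangle.isRightAlmostSplit {D : Triangle T}
    (hD : IsAuslanderReitenTriangle D) : IsRightAlmostSplit D.mor₂ := by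
  refine ⟨fun h => hD.mor₃_ne_zero ?_, hD.lift⟩
  rw [← cancel_epi D.mor₂, comp_zero]
  exact comp_distTriang_mor_zero₂₃ _ hD.distinguished

theorem radical_le_radicalSq_of_biprod {X Y W Z : T} (e : X ≅ Y ⊞ W)
    (hY : radical k Y Z ≤ radicalSq k Y Z) (hW : radical k W Z ≤ radicalSq k W Z) :
    radical k X Z ≤ radicalSq k X Z := fun f hf => by
  have h1 := comp_mem_radicalSq k (e.hom ≫ biprod.fst)
    (hY (comp_mem_radical_left k (biprod.inl ≫ e.inv) hf)) (𝟙 Z)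
  have h2 := comp_mem_radicalSq k (e.hom ≫ biprod.snd)
    (hW (comp_mem_radical_left k (biprod.inr ≫ e.inv) hf)) (𝟙 Z)
  convert Submodule.add_mem _ h1 h2
  have : f = e.hom ≫ (biprod.fst ≫ biprod.inl + biprod.snd ≫ biprod.inr) ≫ e.inv ≫ f := by simp
  rw [this]
  simp only [Preadditive.add_comp, Preadditive.comp_add, Category.assoc, Category.comp_id]
  simp

end Triangulated

/-! ### Components isomorphic to `A₁` -/

section Components

variable {k : Type u} [Field k] {T : Type v} [Category.{w} T] [Preadditive T] [Linear k T]
  [HasZeroObject T] [HasShift T ℤ] [∀ n : ℤ, (shiftFunctor T n).Additive] [Pretriangulated T]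

/-- An arrow ending in `Λ` also starts in `Λ`, so it would give an arrow of `A₁`. -/
theorem ARComponent.IsA1.isEmpty_hom {Λ : ARComponent k T} (hΛ : Λ.IsA1) {x y : ARQuiver k T}
    (hy : (y : Quiver.WeaklyConnectedComponent _) = Λ) : IsEmpty (x ⟶ y) := by
  obtain ⟨F⟩ := hΛ
  refine ⟨fun f => ?_⟩
  have hx : (x : Quiver.WeaklyConnectedComponent _) = Λ := by
    rw [← hy, Quiver.WeaklyConnectedComponent.eq]
    exact ⟨(Quiver.Hom.toPath (Quiver.Symmetrify.of.map f) :)⟩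
  exact (F.arrowEquiv (⟨x, hx⟩ : ComponentVertex Λ) ⟨y, hy⟩ f).elim

theorem exists_iso_out (X : T) (hX : Indecomposable X) :
    Nonempty ((Quotient.out (Quotient.mk (indecomposableSetoid T) ⟨X, hX⟩)).1 ≅ X) :=
  Quotient.mk_out (s := indecomposableSetoid T) ⟨X, hX⟩

theorem ARComponent.IsA1.radical_le_radicalSq {Λ : ARComponent k T} (hΛ : Λ.IsA1) {X Z : T}
    (hX : Indecomposable X) (hZ : Indecomposable Z) (hZΛ : componentOf k Z hZ = Λ) :
    radical k X Z ≤ radicalSq k X Z := by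
  obtain ⟨e⟩ := exists_iso_out X hX
  obtain ⟨e'⟩ := exists_iso_out Z hZ
  refine radical_le_radicalSq_of_iso k e e' ?_
  have h : IsEmpty (Module.Free.ChooseBasisIndex k (Irr k _ _)) :=
    hΛ.isEmpty_hom (x := Quotient.mk (indecomposableSetoid T) ⟨X, hX⟩) hZΛ
  exact Submodule.submoduleOf_eq_top.1 (Submodule.Quotient.subsingleton_iff.1
    (Module.Free.chooseBasis k _).repr.toEquiv.subsingleton)

theorem ARQuiver.isEmpty_hom (h : ∀ X Y : T, Indecomposable X → Indecomposable Y →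
    radical k X Y = ⊥) (x y : ARQuiver k T) : IsEmpty (x ⟶ y) := by
  have h1 := h _ _ (Quotient.out x).2 (Quotient.out y).2
  have : Subsingleton (radical k (Quotient.out x).1 (Quotient.out y).1) := by
    rw [h1]; infer_instance
  have : Subsingleton (Irr k (Quotient.out x).1 (Quotient.out y).1) :=
    (Submodule.Quotient.mk_surjective _).subsingleton
  exact ⟨fun f => (Module.Free.chooseBasis k (Irr k _ _)).ne_zero f (Subsingleton.elim _ _)⟩

theorem eq_of_weaklyConnectedComponent_eq {V : Type*} [Quiver V]
    (h : ∀ x y : V, IsEmpty (x ⟶ y)) {x y : V}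
    (hxy : (x : Quiver.WeaklyConnectedComponent V) = y) : x = y := by
  obtain ⟨p⟩ := (Quiver.WeaklyConnectedComponent.eq x y).1 hxy
  cases p with
  | nil => rfl
  | cons _ f => 
    obtain f | f := f
    · exact ((h _ _).false f).elim
    · exact ((h _ _).false f).elim

theorem ARComponent.isA1 (h : ∀ x y : ARQuiver k T, IsEmpty (x ⟶ y)) (Λ : ARComponent k T) :
    Λ.IsA1 := by
  obtain ⟨x, rfl⟩ := Quotient.exists_rep Λ
  change ARComponent.IsA1 (Quiver.WeaklyConnectedComponent.mk x)
  let e : ComponentVertex (Quiver.WeaklyConnectedComponent.mk x) ≃ QuiverA1 :=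
    ⟨fun _ => QuiverA1.vertex, fun _ => ⟨x, rfl⟩,
      fun y => Subtype.ext (eq_of_weaklyConnectedComponent_eq h y.2).symm, fun _ => rfl⟩
  refine ⟨⟨e, fun y z => ?_⟩⟩
  have : IsEmpty (y ⟶ z) := h _ _
  exact @Equiv.equivOfIsEmpty _ _ this (inferInstanceAs (IsEmpty Empty))

theorem nonempty_iso_of_componentOf_eq (h : ∀ x y : ARQuiver k T, IsEmpty (x ⟶ y)) {X Y : T}
    (hX : Indecomposable X) (hY : Indecomposable Y)
    (hXY : componentOf k X hX = componentOf k Y hY) : Nonempty (X ≅ Y) :=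
  Quotient.exact (eq_of_weaklyConnectedComponent_eq h hXY)

end Components

/-! ### Morphisms between complexes and objects in one degree -/

section Complexes

variable {C : Type u} [Category.{v} C] [Abelian C]

open HomologicalComplex CochainComplex.HomComplex

/-- A morphism from a projective object to the homology of a complex lifts to the complex. -/
theorem exists_hom_from_single (K : CochainComplex C ℤ) (n : ℤ) (P : C) [Projective P]
    (φ : P ⟶ K.homology n) :
    ∃ f : (single C (ComplexShape.up ℤ) n).obj P ⟶ K,
      homologyMap f n = (singleObjHomologySelfIso _ n P).hom ≫ φ := by
  let z := Projective.factorThru φ (K.homologyπ n)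
  refine ⟨mkHomFromSingle (z ≫ K.iCycles n) (by simp), ?_⟩
  rw [← cancel_epi (homologyπ _ n), homologyπ_naturality,
    homologyπ_singleObjHomologySelfIso_hom_assoc, ← Projective.factorThru_comp φ (K.homologyπ n),
    ← Category.assoc]
  congr 1
  rw [← cancel_mono (K.iCycles n)]
  simp [singleObjCyclesSelfIso_hom, z]

/-- A morphism from the homology of a complex to an injective object extends to the complex. -/
theorem exists_hom_to_single (K : CochainComplex C ℤ) (n : ℤ) (I : C) [Injective I]
    (φ : K.homology n ⟶ I) :
    ∃ f : K ⟶ (single C (ComplexShape.up ℤ) n).obj I,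
      homologyMap f n ≫ (singleObjHomologySelfIso _ n I).hom = φ := by
  let z := Injective.factorThru φ (K.homologyι n)
  refine ⟨mkHomToSingle (K.pOpcycles n ≫ z) (by simp), ?_⟩
  rw [← cancel_mono (singleObjOpcyclesSelfIso _ n I).hom, Category.assoc,
    singleObjHomologySelfIso_hom_singleObjOpcyclesSelfIso_hom, homologyι_naturality,
    ← Injective.comp_factorThru φ (K.homologyι n), Category.assoc]
  congr 1
  rw [← cancel_epi (K.pOpcycles n)]
  simp [singleObjOpcyclesSelfIso_hom, z]

/-- A morphism from a complex to an injective object in degree `n` is null-homotopic if it induces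
zero on homology. -/
theorem nonempty_homotopy_zero (K : CochainComplex C ℤ) (n : ℤ) (I : C) [Injective I]
    (f : K ⟶ (single C (ComplexShape.up ℤ) n).obj I) (hf : homologyMap f n = 0) :
    Nonempty (Homotopy f 0) := by
  have h1 : cyclesMap f n = 0 := by
    have : Mono (homologyπ ((single C (ComplexShape.up ℤ) n).obj I) n) := by
      rw [← singleObjHomologySelfIso_hom_singleObjHomologySelfIso_inv]
      infer_instance
    rw [← cancel_mono (homologyπ _ n), ← homologyπ_naturality, hf, comp_zero, zero_comp]
  have h2 : K.iCycles n ≫ f.f n = 0 := by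
    rw [← cyclesMap_i, h1, zero_comp]
  have hS : (ShortComplex.mk (K.iCycles n) (K.d n (n + 1)) (by simp)).Exact :=
    ShortComplex.exact_of_f_is_kernel _ (K.cyclesIsKernel n (n + 1) (by simp))
  -- Since `f` vanishes on cycles in degree `n`, injectivity of `I` writes it as `d ≫ g`; this `g`
  -- is the homotopy.
  let g := hS.descToInjective (f.f n ≫ (singleObjXSelf _ n I).hom) (by simp [reassoc_of% h2])
  have hg : K.d n (n + 1) ≫ g = f.f n ≫ (singleObjXSelf _ n I).hom :=
    hS.comp_descToInjective _ _
  let z : Cochain K ((single C (ComplexShape.up ℤ) n).obj I) (-1) :=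
    Cochain.toSingleMk g (by lia : n + 1 + -1 = n)
  have hz : δ (-1) 0 z = Cochain.toSingleMk (K.d n (n + 1) ≫ g) (add_zero n) := by
    refine (Cochain.δ_toSingleMk g _ 0 n (by lia)).trans ?_
    simp
  refine ⟨(Cochain.equivHomotopy f 0).symm ⟨z, ?_⟩⟩
  rw [hz, hg, Cochain.ofHom_zero]
  refine Eq.trans ?_ (add_zero _).symm
  apply (Cochain.toSingleEquiv (X := I) (add_zero n)).injective
  refine Eq.trans ?_ (Cochain.toSingleEquiv_toSingleMk _ _).symm
  exact congrArg (· ≫ (singleObjXSelf _ n I).hom) (Cochain.ofHom_v f n)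

instance isKInjective_single (n : ℤ) (I : C) [Injective I] :
    CochainComplex.IsKInjective ((single C (ComplexShape.up ℤ) n).obj I) := by
  have (i : ℤ) : Injective (((single C (ComplexShape.up ℤ) n).obj I).X i) := by
    by_cases h : i = n
    · subst h
      exact Injective.of_iso (singleObjXSelf _ i I).symm inferInstance
    · exact (isZero_single_obj_X _ n I i h).injective
  exact CochainComplex.isKInjective_of_injective _ n

end Complexes

/-! ### Homology and one-degree objects in the derived category -/

section Derived

variable {C : Type u} [Category.{v} C] [Abelian C] [HasDerivedCategory.{w} C]

open DerivedCategory

open scoped ZeroObject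

/-- The homology of the image of a complex in the derived category. -/
noncomputable def homologyQIso (K : CochainComplex C ℤ) (n : ℤ) :
    (homologyFunctor C n).obj (Q.obj K) ≅ K.homology n :=
  (homologyFunctorFactors C n).app K

theorem homologyQIso_naturality {K L : CochainComplex C ℤ} (f : K ⟶ L) (n : ℤ) :
    (homologyFunctor C n).map (Q.map f) ≫ (homologyQIso L n).hom =
      (homologyQIso K n).hom ≫ HomologicalComplex.homologyMap f n :=
  homologyFunctorFactors_hom_naturality f n

/-- The homology in degree `n` of an object placed in degree `n`. -/
noncomputable def homologyQSingleIso (n : ℤ) (X : C) :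
    (homologyFunctor C n).obj (Q.obj ((HomologicalComplex.single C (ComplexShape.up ℤ) n).obj X)) ≅
      X :=
  homologyQIso _ n ≪≫ HomologicalComplex.singleObjHomologySelfIso (ComplexShape.up ℤ) n X

theorem homologyQSingleIso_naturality (n : ℤ) {X Y : C} (f : X ⟶ Y) :
    (homologyFunctor C n).map
        (Q.map ((HomologicalComplex.single C (ComplexShape.up ℤ) n).map f)) ≫
        (homologyQSingleIso n Y).hom = (homologyQSingleIso n X).hom ≫ f := by
  rw [homologyQSingleIso, homologyQSingleIso, Iso.trans_hom, Iso.trans_hom, Category.assoc,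
    reassoc_of% homologyQIso_naturality,
    HomologicalComplex.singleObjHomologySelfIso_hom_naturality]

theorem exists_hom_from_Q_single (W : DerivedCategory C) (n : ℤ) (P : C) [Projective P]
    (φ : P ⟶ (homologyFunctor C n).obj W) :
    ∃ f : Q.obj ((HomologicalComplex.single C (ComplexShape.up ℤ) n).obj P) ⟶ W,
      (homologyFunctor C n).map f = (homologyQSingleIso n P).hom ≫ φ := by
  obtain ⟨K, ⟨e⟩⟩ : ∃ K, Nonempty (Q.obj K ≅ W) := ⟨_, ⟨Q.objObjPreimageIso W⟩⟩
  obtain ⟨f, hf⟩ := exists_hom_from_single K n P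
    (φ ≫ (homologyFunctor C n).map e.inv ≫ (homologyQIso K n).hom)
  refine ⟨Q.map f ≫ e.hom, ?_⟩
  have h := homologyQIso_naturality f n
  rw [hf] at h
  rw [Functor.map_comp, ← Functor.mapIso_hom, ← Iso.eq_comp_inv,
    ← cancel_mono (homologyQIso K n).hom, h, homologyQSingleIso]
  simp only [Category.assoc, Iso.trans_hom, Functor.mapIso_inv]

theorem exists_hom_to_Q_single (W : DerivedCategory C) (n : ℤ) (I : C) [Injective I]
    (φ : (homologyFunctor C n).obj W ⟶ I) :
    ∃ f : W ⟶ Q.obj ((HomologicalComplex.single C (ComplexShape.up ℤ) n).obj I),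
      (homologyFunctor C n).map f ≫ (homologyQSingleIso n I).hom = φ := by
  obtain ⟨K, ⟨e⟩⟩ : ∃ K, Nonempty (Q.obj K ≅ W) := ⟨_, ⟨Q.objObjPreimageIso W⟩⟩
  obtain ⟨f, hf⟩ := exists_hom_to_single K n I
    ((homologyQIso K n).inv ≫ (homologyFunctor C n).map e.hom ≫ φ)
  refine ⟨e.inv ≫ Q.map f, ?_⟩
  rw [homologyQSingleIso, Iso.trans_hom, Functor.map_comp, Category.assoc,
    reassoc_of% homologyQIso_naturality, hf, Iso.hom_inv_id_assoc, ← Functor.map_comp_assoc,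
    Iso.inv_hom_id, CategoryTheory.Functor.map_id, Category.id_comp]

theorem eq_zero_of_homology_map_eq_zero_Q_single (W : DerivedCategory C) (n : ℤ) (I : C)
    [Injective I] (f : W ⟶ Q.obj ((HomologicalComplex.single C (ComplexShape.up ℤ) n).obj I))
    (hf : (homologyFunctor C n).map f = 0) : f = 0 := by
  obtain ⟨K, ⟨e⟩⟩ : ∃ K, Nonempty (Q.obj K ≅ W) := ⟨_, ⟨Q.objObjPreimageIso W⟩⟩
  -- An injective object in one degree is K-injective, so `f` is represented by an honest chain map
  -- out of `K`.
  obtain ⟨g, hg⟩ := (CochainComplex.IsKInjective.Qh_map_bijective _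
    ((HomologicalComplex.single C (ComplexShape.up ℤ) n).obj I)).surjective
    ((quotientCompQhIso C).hom.app K ≫ (e.hom ≫ f) ≫ (quotientCompQhIso C).inv.app _)
  obtain ⟨g, rfl⟩ := (HomotopyCategory.quotient C (ComplexShape.up ℤ)).map_surjective g
  have hg' : e.hom ≫ f = Q.map g := by
    have h := quotientCompQhIso_hom_naturality g
    rw [hg] at h
    refine (cancel_epi ((quotientCompQhIso C).hom.app K)).1 (Eq.trans ?_ h)
    rw [Category.assoc, Category.assoc, Category.assoc, Iso.inv_hom_id_app]
    exact (congrArg (fun t => (quotientCompQhIso C).hom.app K ≫ e.hom ≫ t)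
      (Category.comp_id f)).symm
  have h0 : HomologicalComplex.homologyMap g n = 0 := by
    have h := homologyQIso_naturality g n
    rw [← hg', Functor.map_comp, hf, comp_zero, zero_comp] at h
    rw [← cancel_epi (homologyQIso K n).hom, ← h, comp_zero]
  obtain ⟨h⟩ := nonempty_homotopy_zero K n I g h0
  rw [← cancel_epi e.hom, comp_zero, hg', DerivedCategory.Q_map_eq_of_homotopy C h,
    Functor.map_zero]

/-- The homology in degree `n` of an object placed in degree `n`. -/
noncomputable def singleHomologyIso (n : ℤ) (X : C) :
    (homologyFunctor C n).obj ((singleFunctor C n).obj X) ≅ X :=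
  homologyQSingleIso n X

theorem singleHomologyIso_naturality (n : ℤ) {X Y : C} (f : X ⟶ Y) :
    (homologyFunctor C n).map ((singleFunctor C n).map f) ≫ (singleHomologyIso n Y).hom =
      (singleHomologyIso n X).hom ≫ f :=
  homologyQSingleIso_naturality n f

/-- Morphisms from a projective object to the homology lift to the derived category. -/
theorem exists_hom_from_singleFunctor (W : DerivedCategory C) (n : ℤ) (P : C) [Projective P]
    (φ : P ⟶ (homologyFunctor C n).obj W) :
    ∃ f : (singleFunctor C n).obj P ⟶ W,
      (homologyFunctor C n).map f = (singleHomologyIso n P).hom ≫ φ :=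
  exists_hom_from_Q_single W n P φ

/-- Morphisms from the homology to an injective object lift to the derived category. -/
theorem exists_hom_to_singleFunctor (W : DerivedCategory C) (n : ℤ) (I : C) [Injective I]
    (φ : (homologyFunctor C n).obj W ⟶ I) :
    ∃ f : W ⟶ (singleFunctor C n).obj I,
      (homologyFunctor C n).map f ≫ (singleHomologyIso n I).hom = φ :=
  exists_hom_to_Q_single W n I φ

/-- Morphisms to an injective object in degree `n` are detected by homology. -/
theorem eq_zero_of_homology_map_eq_zero (W : DerivedCategory C) (n : ℤ) (I : C) [Injective I]
    (f : W ⟶ (singleFunctor C n).obj I) (hf : (homologyFunctor C n).map f = 0) : f = 0 :=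
  eq_zero_of_homology_map_eq_zero_Q_single W n I f hf

theorem isZero_of_isZero_homology (W : DerivedCategory C)
    (h : ∀ n, IsZero ((homologyFunctor C n).obj W)) : IsZero W := by
  have : IsIso (0 : W ⟶ 0) := by
    rw [isIso_iff]
    intro n
    exact ⟨0, (h n).eq_of_src _ _,
      (Functor.map_isZero (homologyFunctor C n) (isZero_zero _)).eq_of_src _ _⟩
  exact (isZero_zero _).of_iso (asIso (0 : W ⟶ 0))

theorem homology_singleFunctor_isZero (n i : ℤ) (hi : i ≠ n) (X : C) :
    IsZero ((homologyFunctor C i).obj ((singleFunctor C n).obj X)) := 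
  (HomologicalComplex.isZero_single_obj_homology (ComplexShape.up ℤ) n X i hi).of_iso
    ((homologyFunctorFactors C i).app _)

end Derived

/-! ### Split sinks: idempotents, shifts and triangles -/

open scoped ZeroObject

theorem eq_id_of_idempotent_of_epi {T : Type v} [Category.{w} T] {Z : T} (a : Z ⟶ Z)
    (h : a ≫ a = a) [Epi a] : a = 𝟙 Z := by
  rw [← cancel_epi a, h, Category.comp_id]

/-- The pushout of a monomorphism along a morphism to `M` is a monomorphism out of `M`; a retraction
of it provides the extension. -/
theorem injective_of_isSplitMono {T : Type v} [Category.{w} T] [Abelian T] {M : T}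
    (h : ∀ (N : T) (i : M ⟶ N), Mono i → IsSplitMono i) : Injective M := by
  refine ⟨fun {X Y} g f hf => ?_⟩
  have := h _ (pushout.inr f g) inferInstance
  refine ⟨pushout.inl f g ≫ retraction (pushout.inr f g), ?_⟩
  rw [pushout.condition_assoc, IsSplitMono.id, Category.comp_id]

theorem IsSplitSink.shift {T : Type v} [Category.{w} T] [Preadditive T] [HasShift T ℤ]
    [∀ n : ℤ, (shiftFunctor T n).Additive] {Z : T}
    (hZ : IsSplitSink Z) (n : ℤ) : IsSplitSink (Z⟦n⟧) := by
  refine ⟨fun h => hZ.1 ?_, fun W f hf => ?_⟩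
  · rw [IsZero.iff_id_eq_zero] at h ⊢
    apply (shiftFunctor T n).map_injective
    simpa using h
  · have h1 : IsSplitSink (Z⟦n⟧⟦-n⟧) := hZ.of_iso ((shiftEquiv T n).unitIso.app Z)
    have := h1.2 _ (f⟦-n⟧') fun h => hf ((shiftFunctor T (-n)).map_injective (by simpa using h))
    exact ((shiftFunctor T (-n)).isSplitEpi_iff f).1 this

section SplitSink

variable {T : Type v} [Category.{w} T] [Preadditive T] [HasBinaryBiproducts T]

theorem indecomposable_of_idempotents {Z : T} (hZ : ¬ IsZero Z)
    (h : ∀ a b : Z ⟶ Z, a ≫ a = a → b ≫ b = b → a + b = 𝟙 Z → a = 0 ∨ b = 0) :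
    Indecomposable Z := by
  refine ⟨hZ, fun X Y e => ?_⟩
  refine (h (e.hom ≫ biprod.fst ≫ biprod.inl ≫ e.inv) (e.hom ≫ biprod.snd ≫ biprod.inr ≫ e.inv)
    (by simp) (by simp) ?_).imp (fun h => ?_) (fun h => ?_)
  · have : 𝟙 Z = e.hom ≫ (biprod.fst ≫ biprod.inl + biprod.snd ≫ biprod.inr) ≫ e.inv := by simp
    rw [this]
    simp only [Preadditive.add_comp, Preadditive.comp_add, Category.assoc]
  · rw [IsZero.iff_id_eq_zero]
    simpa using congrArg (fun t => biprod.inl ≫ e.inv ≫ t ≫ e.hom ≫ biprod.fst) h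
  · rw [IsZero.iff_id_eq_zero]
    simpa using congrArg (fun t => biprod.inr ≫ e.inv ≫ t ≫ e.hom ≫ biprod.snd) h

/-- A nonzero idempotent of `Z` is a retraction, hence epi, hence the identity. -/
theorem IsSplitSink.indecomposable {Z : T} (hZ : IsSplitSink Z) : Indecomposable Z := by
  refine indecomposable_of_idempotents hZ.1 fun a b ha _ hab => ?_
  by_cases h : a = 0
  · exact Or.inl h
  · have := hZ.2 _ a h
    rw [eq_id_of_idempotent_of_epi a ha] at hab
    exact Or.inr (by simpa using hab)

/-- A split sink is the end of an Auslander-Reiten triangle with middle term zero. -/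
theorem IsSplitSink.exists_isAuslanderReitenTriangle [HasZeroObject T] [HasShift T ℤ]
    [∀ n : ℤ, (shiftFunctor T n).Additive] [Pretriangulated T] {X Z : T} (hX : IsSplitSink X)
    (hZ : IsSplitSink Z) (e : Z ≅ X⟦(1 : ℤ)⟧) :
    ∃ D : Triangle T, IsAuslanderReitenTriangle D ∧ IsZero D.obj₂ ∧ D.obj₁ = X ∧ D.obj₃ = Z := by
  have h0 : e.hom ≠ 0 := fun h => hZ.1 (by
    rw [IsZero.iff_id_eq_zero, ← e.hom_inv_id, h, zero_comp])
  have hT : Triangle.mk (0 : X ⟶ 0) (0 : 0 ⟶ Z) e.hom ∈ distTriang T := by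
    refine isomorphic_distinguished _ (contractible_distinguished₂ X) _ ?_
    exact Triangle.isoMk _ _ (Iso.refl _) (Iso.refl _) e (zero_comp.trans comp_zero.symm)
      (zero_comp.trans comp_zero.symm)
      (congrArg (e.hom ≫ ·) (CategoryTheory.Functor.map_id _ _))
  exact ⟨_, ⟨hT, hX.indecomposable, hZ.indecomposable, h0, fun W f hf => ⟨0, by
    by_contra h
    exact hf (hZ.2 _ f fun h' => h (zero_comp.trans h'.symm))⟩⟩, isZero_zero _, rfl, rfl⟩

end SplitSink

/-! ### Split sinks and almost split morphisms in the bounded derived category -/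

section Bounded

variable {C : Type u} [Category.{v} C] [Abelian C] [HasDerivedCategory.{w} C]

open DerivedCategory

variable (C) in
/-- The homology functors on the bounded derived category. -/
noncomputable abbrev boundedHomology (n : ℤ) : Bounded C ⥤ C := Bounded.ι ⋙ homologyFunctor C n

variable (C) in
/-- The embedding in degree `n` of an abelian category in its bounded derived category. -/
noncomputable def boundedSingle (n : ℤ) : C ⥤ Bounded C :=
  ObjectProperty.lift _ (singleFunctor C n) fun X => by
    constructor
    · exact ⟨n, inferInstance⟩
    · exact ⟨n, inferInstance⟩

instance (n : ℤ) : (boundedSingle C n).Full where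
  map_surjective f := by
    obtain ⟨g, hg⟩ := (singleFunctor C n).map_surjective f.hom
    exact ⟨g, ObjectProperty.hom_ext _ hg⟩

instance (n : ℤ) : (boundedSingle C n).Faithful where
  map_injective h :=
    (singleFunctor C n).map_injective (congrArg Bounded.ι.map h)

instance (n : ℤ) : (boundedSingle C n).Additive where
  map_add {_ _ _ _} := ObjectProperty.hom_ext _ (singleFunctor C n).map_add

/-- The homology in degree `n` of an object placed in degree `n`. -/
noncomputable def boundedSingleHomologyIso (n : ℤ) (X : C) :
    (boundedHomology C n).obj ((boundedSingle C n).obj X) ≅ X :=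
  singleHomologyIso n X

theorem boundedSingleHomologyIso_naturality (n : ℤ) {X Y : C} (f : X ⟶ Y) :
    (boundedHomology C n).map ((boundedSingle C n).map f) ≫ (boundedSingleHomologyIso n Y).hom =
      (boundedSingleHomologyIso n X).hom ≫ f :=
  singleHomologyIso_naturality n f

theorem exists_hom_from_boundedSingle (W : Bounded C) (n : ℤ) (P : C) [Projective P]
    (φ : P ⟶ (boundedHomology C n).obj W) :
    ∃ f : (boundedSingle C n).obj P ⟶ W,
      (boundedHomology C n).map f = (boundedSingleHomologyIso n P).hom ≫ φ := by
  obtain ⟨f, hf⟩ := exists_hom_from_singleFunctor W.obj n P φ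
  exact ⟨ObjectProperty.homMk f, hf⟩

theorem exists_hom_to_boundedSingle (W : Bounded C) (n : ℤ) (I : C) [Injective I]
    (φ : (boundedHomology C n).obj W ⟶ I) :
    ∃ f : W ⟶ (boundedSingle C n).obj I,
      (boundedHomology C n).map f ≫ (boundedSingleHomologyIso n I).hom = φ := by
  obtain ⟨f, hf⟩ := exists_hom_to_singleFunctor W.obj n I φ
  exact ⟨ObjectProperty.homMk f, hf⟩

theorem eq_zero_of_boundedHomology_map_eq_zero {W : Bounded C} {n : ℤ} {I : C} [Injective I]
    (f : W ⟶ (boundedSingle C n).obj I) (hf : (boundedHomology C n).map f = 0) : f = 0 :=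
  ObjectProperty.hom_ext _ (eq_zero_of_homology_map_eq_zero W.obj n I f.hom hf)

theorem isZero_of_isZero_boundedHomology (W : Bounded C)
    (h : ∀ n, IsZero ((boundedHomology C n).obj W)) : IsZero W := by
  have h1 := isZero_of_isZero_homology W.obj h
  rw [IsZero.iff_id_eq_zero] at h1 ⊢
  exact ObjectProperty.hom_ext _ h1

theorem isZero_boundedHomology_boundedSingle {n i : ℤ} (hi : i ≠ n) (X : C) :
    IsZero ((boundedHomology C i).obj ((boundedSingle C n).obj X)) :=
  homology_singleFunctor_isZero n i hi X

theorem exists_finset_isZero_boundedHomology (W : Bounded C) :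
    ∃ s : Finset ℤ, ∀ i ∉ s, IsZero ((boundedHomology C i).obj W) := by
  obtain ⟨⟨a, ha⟩, ⟨b, hb⟩⟩ := W.property
  have ha' : W.obj.IsGE a := ha
  have hb' : W.obj.IsLE b := hb
  refine ⟨Finset.Icc a b, fun i hi => ?_⟩
  rw [Finset.mem_Icc, not_and_or, not_le, not_le] at hi
  obtain hi | hi := hi
  · exact W.obj.isZero_of_isGE a i hi
  · exact W.obj.isZero_of_isLE b i hi

theorem eq_id_of_boundedSingle {n : ℤ} {X : C}
    (f : (boundedSingle C n).obj X ⟶ (boundedSingle C n).obj X)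
    (hf : (boundedHomology C n).map f = 𝟙 _) : f = 𝟙 _ := by
  obtain ⟨g, rfl⟩ := (boundedSingle C n).map_surjective f
  have h := boundedSingleHomologyIso_naturality n g
  rw [hf, Category.id_comp] at h
  have : g = 𝟙 X := by
    rw [← cancel_epi (boundedSingleHomologyIso n X).hom, ← h, Category.comp_id]
  rw [this, CategoryTheory.Functor.map_id]

/-- A morphism to a projective object in degree `n` is a retraction if it is epi on homology. -/
theorem isSplitEpi_of_epi_boundedHomology {W : Bounded C} {n : ℤ} {P : C} [Projective P]
    (f : W ⟶ (boundedSingle C n).obj P) (hf : Epi ((boundedHomology C n).map f)) :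
    IsSplitEpi f := by
  let t := Projective.factorThru (boundedSingleHomologyIso n P).inv ((boundedHomology C n).map f)
  have ht : t ≫ (boundedHomology C n).map f = (boundedSingleHomologyIso n P).inv :=
    Projective.factorThru_comp _ _
  obtain ⟨s, hs⟩ := exists_hom_from_boundedSingle W n P t
  refine IsSplitEpi.mk' ⟨s, eq_id_of_boundedSingle _ ?_⟩
  rw [Functor.map_comp, hs, Category.assoc, ht, Iso.hom_inv_id]

/-- A morphism in the abelian category whose composites with non-epimorphisms vanish yields a right
almost split morphism in the bounded derived category. -/
theorem exists_isRightAlmostSplit {P I : C} [Projective P] [Injective I] (w : P ⟶ I) (hw : w ≠ 0)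
    (h : ∀ (N : C) (g : N ⟶ P), ¬ Epi g → g ≫ w = 0) :
    Indecomposable ((boundedSingle C 0).obj P) ∧
      ∃ (E : Bounded C) (v : E ⟶ (boundedSingle C 0).obj P), IsRightAlmostSplit v := by
  constructor
  · refine indecomposable_of_idempotents (fun hP => hw ?_) fun a b ha hb hab => ?_
    · apply (boundedSingle C 0).map_injective
      exact hP.eq_of_src _ _
    · obtain ⟨a, rfl⟩ := (boundedSingle C 0).map_surjective a
      obtain ⟨b, rfl⟩ := (boundedSingle C 0).map_surjective b
      rw [← Functor.map_comp] at ha hb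
      replace ha := (boundedSingle C 0).map_injective ha
      replace hb := (boundedSingle C 0).map_injective hb
      rw [← Functor.map_add, ← CategoryTheory.Functor.map_id] at hab
      replace hab := (boundedSingle C 0).map_injective hab
      by_cases h1 : Epi a
      · rw [eq_id_of_idempotent_of_epi a ha] at hab
        right
        rw [show b = 0 by simpa using hab, Functor.map_zero]
      · by_cases h2 : Epi b
        · rw [eq_id_of_idempotent_of_epi b hb] at hab
          left
          rw [show a = 0 by simpa using hab, Functor.map_zero]
        -- Neither idempotent is epi, so `w` is killed by both and by their sum, the identity.
        · refine (hw ?_).elim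
          rw [← Category.id_comp w, ← hab, Preadditive.add_comp, h _ a h1, h _ b h2, add_zero]
  · obtain ⟨E, v, d, hT⟩ := distinguished_cocone_triangle₁ ((boundedSingle C 0).map w)
    refine ⟨E, v, fun hv => hw ?_, fun W f hf => ?_⟩
    · apply (boundedSingle C 0).map_injective
      rw [← cancel_epi v, Functor.map_zero, comp_zero]
      exact comp_distTriang_mor_zero₁₂ _ hT
    -- A non-retraction is not epi on `H⁰`, so `w` kills `H⁰(f)`; the target is injective, so
    -- vanishing on homology suffices.
    · have h1 : f ≫ (boundedSingle C 0).map w = 0 := by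
        apply eq_zero_of_boundedHomology_map_eq_zero
        rw [← cancel_mono (boundedSingleHomologyIso 0 I).hom, zero_comp, Functor.map_comp,
          Category.assoc, boundedSingleHomologyIso_naturality, ← Category.assoc]
        refine h _ _ fun h2 => hf (isSplitEpi_of_epi_boundedHomology f ?_)
        have := @epi_comp _ _ _ _ _ _ h2 (boundedSingleHomologyIso 0 P).inv inferInstance
        simpa using this
      obtain ⟨f', hf'⟩ := Triangle.coyoneda_exact₂ _ hT f h1
      exact ⟨f', hf'.symm⟩

/-- Split sinks in the bounded derived category are given by objects of the abelian category which
are projective, injective and simple. -/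
theorem IsSplitSink.exists_of_generator {Z : Bounded C} (hZ : IsSplitSink Z) (G : C) [Projective G]
    (hG : ∀ N : C, ¬ IsZero N → ∃ f : G ⟶ N, f ≠ 0) :
    ∃ M : C, IsSplitSink M ∧ Injective M := by
  obtain ⟨n, hn⟩ : ∃ n, ¬ IsZero ((boundedHomology C n).obj Z) := by
    by_contra! h
    exact hZ.1 (isZero_of_isZero_boundedHomology Z h)
  obtain ⟨φ, hφ⟩ := hG _ hn
  obtain ⟨f, hf⟩ := exists_hom_from_boundedSingle Z n G φ
  have hf0 : f ≠ 0 := by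
    rintro rfl
    rw [Functor.map_zero] at hf
    exact hφ (by rw [← cancel_epi (boundedSingleHomologyIso n G).hom, ← hf, comp_zero])
  have := hZ.2 _ f hf0
  -- The idempotent cutting out `Z` comes from an idempotent of `G`, whose image `M` placed in
  -- degree `n` is `Z`.
  obtain ⟨a, ha⟩ := (boundedSingle C n).map_surjective (f ≫ section_ f)
  have haa : a ≫ a = a := by
    apply (boundedSingle C n).map_injective
    rw [Functor.map_comp, ha]
    simp
  obtain ⟨M, i, p, hip, hpi⟩ := IsIdempotentComplete.idempotents_split G a haa
  have hM : IsSplitSink ((boundedSingle C n).obj M) := by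
    refine hZ.of_iso ⟨section_ f ≫ (boundedSingle C n).map p, (boundedSingle C n).map i ≫ f, ?_, ?_⟩
    · rw [Category.assoc, ← Functor.map_comp_assoc, hpi, ha]
      simp
    · rw [Category.assoc, ← Category.assoc f, ← ha, ← Functor.map_comp, ← Functor.map_comp, ← hpi,
        Category.assoc, hip, Category.comp_id, hip, CategoryTheory.Functor.map_id]
  have hM0 : ¬ IsZero M := fun h => hM.1 (Functor.map_isZero _ h)
  refine ⟨M, ⟨hM0, fun N g hg => ?_⟩, ?_⟩
  · have := hM.2 _ ((boundedSingle C n).map g)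
      fun h => hg ((boundedSingle C n).map_injective (by simpa using h))
    exact ((boundedSingle C n).isSplitEpi_iff g).1 this
  · refine injective_of_isSplitMono fun N i hi => ?_
    obtain ⟨W, g, d, hT⟩ := distinguished_cocone_triangle₁ ((boundedSingle C n).map i)
    -- A nonzero `g` from the cocone would be a retraction with `g ≫ i = 0`, forcing `i = 0`. Once
    -- `g = 0`, `i` is mono in a triangulated category, hence split.
    have hg : g = 0 := by
      by_contra hg
      have := hM.2 _ g hg
      have h0 : (boundedSingle C n).map i = 0 := by
        rw [← cancel_epi g, comp_zero]
        exact comp_distTriang_mor_zero₁₂ _ hT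
      have h1 : i = 0 := (boundedSingle C n).map_injective (by simpa using h0)
      exact hM0 (by rw [IsZero.iff_id_eq_zero, ← cancel_mono i, h1, comp_zero, comp_zero])
    have : Mono ((boundedSingle C n).map i) := Triangle.mono₂ _ hT hg
    exact ((boundedSingle C n).isSplitMono_iff i).1 (isSplitMono_of_mono _)

end Bounded

open DerivedCategory

/-! ### Decomposition into indecomposables -/

section Decomposition

variable {C : Type u} [Category.{v} C] [Abelian C] [HasDerivedCategory.{w} C]

/-- Objects of the bounded derived category are built from indecomposable objects by finite
direct sums if there is an additive length function on the abelian category. -/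
theorem bounded_induction (ℓ : C → ℕ) (hℓ : ∀ X, ¬ IsZero X → 0 < ℓ X)
    (hℓ' : ∀ X Y Z : C, (X ≅ Y ⊞ Z) → ℓ X = ℓ Y + ℓ Z) (p : Bounded C → Prop)
    (h0 : ∀ X, IsZero X → p X) (h1 : ∀ X, Indecomposable X → p X)
    (h2 : ∀ X Y Z : Bounded C, (X ≅ Y ⊞ Z) → p Y → p Z → p X) (X : Bounded C) : p X := by
  obtain ⟨s, hs⟩ := exists_finset_isZero_boundedHomology X
  -- Induction on the total length of homology. The set `s` stays fixed, as it also supports the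
  -- homology of every summand.
  generalize hn : ∑ i ∈ s, ℓ ((boundedHomology C i).obj X) = n
  induction n using Nat.strong_induction_on generalizing X with
  | _ n ih =>
    by_cases hX0 : IsZero X
    · exact h0 X hX0
    by_cases hX : Indecomposable X
    · exact h1 X hX
    rw [Indecomposable] at hX
    push Not at hX
    obtain ⟨Y, Z, e, hY, hZ⟩ := hX hX0
    have (i : ℤ) : PreservesBinaryBiproducts (boundedHomology C i) :=
      preservesBinaryBiproducts_of_preservesBiproducts _
    have e' (i : ℤ) : (boundedHomology C i).obj X ≅
        (boundedHomology C i).obj Y ⊞ (boundedHomology C i).obj Z :=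
      (boundedHomology C i).mapIso e ≪≫ (boundedHomology C i).mapBiprod Y Z
    have hs' (i : ℤ) (hi : i ∉ s) := (biprod_isZero_iff _ _).1 ((hs i hi).of_iso (e' i).symm)
    have hpos (W : Bounded C) (hW : ¬ IsZero W)
        (hsW : ∀ i ∉ s, IsZero ((boundedHomology C i).obj W)) :
        0 < ∑ i ∈ s, ℓ ((boundedHomology C i).obj W) := by
      obtain ⟨i, hi⟩ : ∃ i, ¬ IsZero ((boundedHomology C i).obj W) := by
        by_contra! h
        exact hW (isZero_of_isZero_boundedHomology W h)
      exact Finset.sum_pos' (fun _ _ => Nat.zero_le _)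
        ⟨i, by_contra fun h => hi (hsW i h), hℓ _ hi⟩
    have hsum : n = ∑ i ∈ s, ℓ ((boundedHomology C i).obj Y) +
        ∑ i ∈ s, ℓ ((boundedHomology C i).obj Z) := by
      rw [← hn, ← Finset.sum_add_distrib]
      exact Finset.sum_congr rfl fun i _ => hℓ' _ _ _ (e' i)
    have hpY := hpos Y hY fun i hi => (hs' i hi).1
    have hpZ := hpos Z hZ fun i hi => (hs' i hi).2
    exact h2 X Y Z e (ih _ (by omega) Y (fun i hi => (hs' i hi).1) rfl)
      (ih _ (by omega) Z (fun i hi => (hs' i hi).2) rfl)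

end Decomposition

/-! ### The semisimple case with one simple object -/

section Semisimple

variable {C : Type u} [Category.{v} C] [Abelian C] [HasDerivedCategory.{w} C]
  [∀ X : C, Projective X] [∀ X : C, Injective X] {S : C} [Simple S]

/-- A nonzero `f` is nonzero on homology since `S` is injective, hence epi there since `S` is
simple, hence a retraction since `S` is projective. -/
theorem isSplitSink_boundedSingle_of_simple (S : C) [Simple S] (n : ℤ) :
    IsSplitSink ((boundedSingle C n).obj S) := by
  refine ⟨fun h => Simple.not_isZero S ?_, fun W f hf => ?_⟩
  · rw [IsZero.iff_id_eq_zero] at h ⊢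
    exact (boundedSingle C n).map_injective (by simpa using h)
  · have h1 : (boundedHomology C n).map f ≫ (boundedSingleHomologyIso n S).hom ≠ 0 := fun h =>
      hf (eq_zero_of_boundedHomology_map_eq_zero f
        (by rw [← cancel_mono (boundedSingleHomologyIso n S).hom, h, zero_comp]))
    have h2 := epi_of_nonzero_to_simple h1
    refine isSplitEpi_of_epi_boundedHomology f ?_
    have h3 := epi_comp ((boundedHomology C n).map f ≫ (boundedSingleHomologyIso n S).hom)
      (boundedSingleHomologyIso n S).inv
    simpa using h3

/-- A copy of `S` in the homology of `X` is a summand by injectivity. The projection onto it lifts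
to a nonzero morphism from `X` to a split sink: a retraction, hence an isomorphism. -/
theorem exists_iso_boundedSingle_of_indecomposable
    (hS : ∀ N : C, ¬ IsZero N → ∃ f : S ⟶ N, f ≠ 0) (X : Bounded C) (hX : Indecomposable X) :
    ∃ n, Nonempty (X ≅ (boundedSingle C n).obj S) := by
  obtain ⟨n, hn⟩ : ∃ n, ¬ IsZero ((boundedHomology C n).obj X) := by
    by_contra! h
    exact hX.1 (isZero_of_isZero_boundedHomology X h)
  obtain ⟨i, hi⟩ := hS _ hn
  have := mono_of_nonzero_from_simple hi
  obtain ⟨f, hf⟩ := exists_hom_to_boundedSingle X n S (Injective.factorThru (𝟙 S) i)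
  have h1 : f ≠ 0 := by
    rintro rfl
    have h2 := Injective.comp_factorThru (𝟙 S) i
    rw [← hf, Functor.map_zero, zero_comp, comp_zero] at h2
    exact id_nonzero S h2.symm
  have hsink := isSplitSink_boundedSingle_of_simple S n
  have := hsink.2 X f h1
  have := isIso_of_isSplitEpi hX hsink.1 f
  exact ⟨n, ⟨asIso f⟩⟩

theorem isSplitSink_of_indecomposable
    (hS : ∀ N : C, ¬ IsZero N → ∃ f : S ⟶ N, f ≠ 0) (X : Bounded C) (hX : Indecomposable X) :
    IsSplitSink X := by
  obtain ⟨n, ⟨e⟩⟩ := exists_iso_boundedSingle_of_indecomposable hS X hX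
  exact (isSplitSink_boundedSingle_of_simple S n).of_iso e.symm

variable (k : Type*) [Field k] [Linear k C]

theorem ARQuiver.isEmpty_hom_of_simple (hS : ∀ N : C, ¬ IsZero N → ∃ f : S ⟶ N, f ≠ 0)
    (x y : ARQuiver k (Bounded C)) : IsEmpty (x ⟶ y) := by
  refine ARQuiver.isEmpty_hom (fun X Y _ hY => ?_) x y
  rw [eq_bot_iff]
  intro f hf
  by_contra h
  exact not_isSplitEpi_of_mem_radical k hY.1 hf ((isSplitSink_of_indecomposable hS Y hY).2 X f h)

theorem infinite_arComponent_of_simple (hS : ∀ N : C, ¬ IsZero N → ∃ f : S ⟶ N, f ≠ 0) :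
    Infinite (ARComponent k (Bounded C)) := by
  refine Infinite.of_injective (fun n : ℤ => componentOf k ((boundedSingle C n).obj S)
    (isSplitSink_boundedSingle_of_simple S n).indecomposable) fun m n hmn => ?_
  obtain ⟨e⟩ := nonempty_iso_of_componentOf_eq (ARQuiver.isEmpty_hom_of_simple k hS) _ _ hmn
  by_contra h
  refine Simple.not_isZero S ?_
  exact (isZero_boundedHomology_boundedSingle h S).of_iso
    ((boundedSingleHomologyIso m S).symm ≪≫ (boundedHomology C m).mapIso e)

theorem isStable_of_simple (hS : ∀ N : C, ¬ IsZero N → ∃ f : S ⟶ N, f ≠ 0)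
    (Λ : ARComponent k (Bounded C)) : Λ.IsStable := by
  intro X hX _
  have h := isSplitSink_of_indecomposable hS X hX
  constructor
  · obtain ⟨D, hD, -, h1, -⟩ := h.exists_isAuslanderReitenTriangle (h.shift 1) (Iso.refl _)
    exact ⟨D, hD, ⟨eqToIso h1⟩⟩
  · obtain ⟨D, hD, -, -, h3⟩ := (h.shift (-1)).exists_isAuslanderReitenTriangle h
      ((shiftEquiv _ (1 : ℤ)).counitIso.app X).symm
    exact ⟨D, hD, ⟨eqToIso h3⟩⟩

end Semisimple

/-! ### Artinian rings: isotypic components and local projectives -/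

section Rings

/-- A finite-dimensional indecomposable algebra with a simple projective injective module is
simple. -/
theorem isSimpleRing_of_simple_projective_injective {k : Type u} {A : Type v} [Field k] [Ring A]
    [Algebra k A] [IsArtinianRing A] (hA : IsIndecomposableAlgebra k A)
    (M : Type v) [AddCommGroup M] [Module A M] [IsSimpleModule A M] [Module.Projective A M]
    (hM : Module.Baer A M) : IsSimpleRing A := by
  have := hA.1
  have := IsSimpleModule.nontrivial A M
  let I : Submodule A A := isotypicComponent A A M
  have hI (s : M →ₗ[A] A) (hs : Function.Injective s) : LinearMap.range s ≤ I :=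
    le_sSup ⟨(LinearEquiv.ofInjective s hs).symm⟩
  have hI2 : Ideal.IsTwoSided I :=
    isFullyInvariant_iff_isTwoSided.1 (Submodule.IsFullyInvariant.isotypicComponent A A M)
  obtain ⟨n, ⟨e⟩⟩ := (IsIsotypicOfType.isotypicComponent A A M).linearEquiv_fun
  change I ≃ₗ[A] Fin n → M at e
  -- Since `I` is a finite power of `M`, its coordinates extend to `A` by Baer's criterion; `J` is
  -- the kernel of the resulting projection.
  obtain ⟨J, hIJ⟩ : ∃ J : Submodule A A, IsCompl I J := by
    choose h hh using fun i : Fin n => hM I (LinearMap.proj i ∘ₗ e.toLinearMap)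
    refine ⟨_, LinearMap.isCompl_of_proj (f := e.symm.toLinearMap ∘ₗ LinearMap.pi h) fun x => ?_⟩
    simp only [LinearMap.comp_apply, LinearEquiv.coe_coe]
    rw [LinearEquiv.symm_apply_eq]
    ext i
    exact hh i x.1 x.2
  -- Otherwise right multiplication by `x` gives a surjection `J → M`. It splits by projectivity,
  -- putting a copy of `M` in `I ∩ J = 0`.
  have hJI (x : A) (hx : x ∈ I) (y : A) (hy : y ∈ J) : y * x = 0 := by
    let φ : J →ₗ[A] I := ((LinearMap.toSpanSingleton A A x).comp J.subtype).codRestrict I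
      fun y => I.smul_mem _ hx
    by_contra h0
    have h1 : e (φ ⟨y, hy⟩) ≠ 0 := fun h => h0 (congrArg Subtype.val ((map_eq_zero_iff e e.injective).1 h))
    obtain ⟨i, hi⟩ := Function.ne_iff.1 h1
    let g : J →ₗ[A] M := LinearMap.proj i ∘ₗ e.toLinearMap ∘ₗ φ
    have hg : Function.Surjective g := (LinearMap.surjective_or_eq_zero g).resolve_right
      fun h => hi (LinearMap.congr_fun h ⟨y, hy⟩)
    obtain ⟨s, hs⟩ := Module.projective_lifting_property g LinearMap.id hg
    have hs' : Function.Injective s := Function.LeftInverse.injective (g := g)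
      fun m => LinearMap.congr_fun hs m
    have h2 := hI (J.subtype ∘ₗ s) (J.subtype_injective.comp hs')
    obtain ⟨m, hm⟩ := exists_ne (0 : M)
    refine hm (hs' ?_)
    rw [map_zero]
    refine Subtype.ext ?_
    exact Submodule.disjoint_def.1 hIJ.disjoint _ (h2 ⟨m, rfl⟩) (s m).2
  have hsup (a : A) : ∃ x ∈ I, ∃ y ∈ J, x + y = a :=
    Submodule.mem_sup.1 (hIJ.sup_eq_top ▸ Submodule.mem_top)
  have hJ2 : Ideal.IsTwoSided J := ⟨fun {x} a hx => by
    obtain ⟨i, hi, j, hj, rfl⟩ := hsup a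
    rw [mul_add, hJI i hi x hx, zero_add]
    exact J.smul_mem x hj⟩
  let F : A →ₐ[k] (A ⧸ I) × (A ⧸ J) := (Ideal.Quotient.mkₐ k I).prod (Ideal.Quotient.mkₐ k J)
  have hF : Function.Bijective F := by
    constructor
    · rw [injective_iff_map_eq_zero]
      intro a ha
      have h1 : a ∈ I := Ideal.Quotient.eq_zero_iff_mem.1 (congrArg Prod.fst ha)
      have h2 : a ∈ J := Ideal.Quotient.eq_zero_iff_mem.1 (congrArg Prod.snd ha)
      exact Submodule.disjoint_def.1 hIJ.disjoint _ h1 h2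
    · rintro ⟨a, b⟩
      obtain ⟨a, rfl⟩ := Ideal.Quotient.mk_surjective a
      obtain ⟨b, rfl⟩ := Ideal.Quotient.mk_surjective b
      obtain ⟨i, hi, j, hj, hij⟩ := hsup (a - b)
      refine ⟨b + j, Prod.ext ?_ ?_⟩
      · refine Ideal.Quotient.eq.2 ?_
        have : b + j - a = -i := by rw [← sub_eq_zero, ← sub_eq_zero.2 hij]; abel
        rw [this]
        exact I.neg_mem hi
      · refine Ideal.Quotient.eq.2 ?_
        simpa using hj
  obtain h | h := hA.2 _ _ ⟨AlgEquiv.ofBijective F hF⟩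
  · have hItop : I = ⊤ := Ideal.Quotient.subsingleton_iff.1 h
    have : IsSemisimpleModule A I := inferInstanceAs (IsSemisimpleModule A (isotypicComponent A A M))
    rw [hItop] at this
    have : IsSemisimpleRing A := IsSemisimpleModule.congr (Submodule.topEquiv (R := A) (M := A)).symm
    exact (isSimpleRing_isArtinianRing_iff.2 ⟨this,
      (IsIsotypicOfType.of_isotypicComponent_eq_top hItop).isIsotypic, hA.1⟩).1
  · have hJtop : J = ⊤ := Ideal.Quotient.subsingleton_iff.1 h
    have hIbot : I = ⊥ := by simpa [hJtop] using hIJ.inf_eq_bot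
    obtain ⟨m, hm⟩ := exists_ne (0 : M)
    obtain ⟨s, hs⟩ := Module.projective_lifting_property (LinearMap.toSpanSingleton A M m)
      LinearMap.id (IsSimpleModule.toSpanSingleton_surjective A hm)
    have hs' : Function.Injective s := Function.LeftInverse.injective
      (g := LinearMap.toSpanSingleton A M m) fun m => LinearMap.congr_fun hs m
    have h1 := hI s hs' ⟨m, rfl⟩
    rw [hIbot, Submodule.mem_bot] at h1
    exact (hm (hs' (by rw [h1, map_zero]))).elim

/-- For a minimal nonzero summand `P` of `A` with complement `Q`, a summand `U` of `P` is again a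
summand of `A`, with complement `V ⊔ Q`. -/
theorem exists_minimal_complemented (A : Type v) [Ring A] [Nontrivial A] [IsArtinianRing A] :
    ∃ P : Submodule A A, P ≠ ⊥ ∧ (∃ Q, IsCompl P Q) ∧
      ∀ U V : Submodule A A, Disjoint U V → U ⊔ V = P → U = ⊥ ∨ V = ⊥ := by
  obtain ⟨P, ⟨hP, Q, hQ⟩, hmin⟩ := (wellFounded_lt (α := Submodule A A)).has_min
    {P | P ≠ ⊥ ∧ ∃ Q, IsCompl P Q} ⟨⊤, top_ne_bot, ⊥, isCompl_top_bot⟩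
  refine ⟨P, hP, ⟨Q, hQ⟩, fun U V hUV hP' => or_iff_not_imp_left.2 fun hU => ?_⟩
  have h1 : IsCompl U (V ⊔ Q) := hUV.isCompl_sup_right_of_isCompl_sup_left (by rwa [hP'])
  have h2 : U = P := eq_of_le_of_not_lt (hP' ▸ le_sup_left) (hmin U ⟨hU, _, h1⟩)
  exact (hUV.symm.eq_bot_of_le (by rw [h2, ← hP']; exact le_sup_right))

/-- A nonzero Artinian ring has a nonzero finitely generated projective module with a submodule
containing all proper submodules. -/
theorem exists_local_projective (A : Type v) [Ring A] [Nontrivial A] [IsArtinianRing A] :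
    ∃ P : Submodule A A, Module.Projective A P ∧
      ∃ N : Submodule A P, N ≠ ⊤ ∧ ∀ U : Submodule A P, U ≠ ⊤ → U ≤ N := by
  obtain ⟨P, hP, ⟨Q, hQ⟩, hmin⟩ := exists_minimal_complemented A
  have hproj : Module.Projective A P :=
    Module.Projective.of_split P.subtype (P.projectionOnto Q hQ)
      (LinearMap.ext fun x => Submodule.projectionOnto_apply_left hQ x)
  have : Nontrivial P := Submodule.nontrivial_iff_ne_bot.2 hP
  have hmin' (U V : Submodule A P) (h : IsCompl U V) : U = ⊥ ∨ V = ⊥ := by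
    have h1 := hmin (U.map P.subtype) (V.map P.subtype)
      ((Submodule.disjoint_map P.subtype_injective h.disjoint))
      (by rw [← Submodule.map_sup, h.sup_eq_top, Submodule.map_subtype_top])
    have h2 := Submodule.map_injective_of_injective P.subtype_injective
    exact h1.imp (fun h => h2 (h.trans (Submodule.map_bot _).symm))
      fun h => h2 (h.trans (Submodule.map_bot _).symm)
  -- Fitting's lemma: by indecomposability `f` is surjective or nilpotent. The exponent must be
  -- positive for surjectivity of `f ^ n` to pass to `f`.
  have hlocal (f : Module.End A P) : Function.Surjective f ∨
      Function.Surjective ((1 : Module.End A P) - f : Module.End A P) := by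
    obtain ⟨n, hn, hn0⟩ := (f.eventually_isCompl_ker_pow_range_pow.and
      (Filter.eventually_ge_atTop 1)).exists
    obtain h | h := hmin' _ _ hn
    · left
      rw [h] at hn
      rw [← LinearMap.range_eq_top, eq_top_iff, ← eq_top_of_bot_isCompl hn, ← Nat.succ_pred_eq_of_pos hn0, pow_succ']
      exact LinearMap.range_comp_le_range _ _
    · right
      have h1 : IsNilpotent f := ⟨n, LinearMap.range_eq_bot.1 h⟩
      exact ((Module.End.isUnit_iff _).1 h1.isUnit_one_sub).2
  -- If `U ⊔ V = ⊤`, splitting `U × V → P` writes the identity as a sum of endomorphisms with images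
  -- in `U` and `V`, one of which is surjective.
  have hsup (U V : Submodule A P) (hU : U ≠ ⊤) (hV : V ≠ ⊤) : U ⊔ V ≠ ⊤ := fun h => by
    have h1 : Function.Surjective (U.subtype.coprod V.subtype) := by
      rw [← LinearMap.range_eq_top, LinearMap.range_coprod]
      simpa using h
    obtain ⟨s, hs⟩ := Module.projective_lifting_property _ LinearMap.id h1
    let f : Module.End A P := U.subtype ∘ₗ LinearMap.fst A U V ∘ₗ s
    have h2 : 1 - f = V.subtype ∘ₗ LinearMap.snd A U V ∘ₗ s := by
      refine LinearMap.ext fun x => ?_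
      have := LinearMap.congr_fun hs x
      simp only [LinearMap.comp_apply, LinearMap.coprod_apply, LinearMap.id_apply] at this
      simp only [LinearMap.sub_apply, Module.End.one_apply, f, LinearMap.comp_apply]
      rw [sub_eq_iff_eq_add, add_comm]
      exact this.symm
    obtain h3 | h3 := hlocal f
    · refine hU (eq_top_iff.2 fun x _ => ?_)
      obtain ⟨y, rfl⟩ := h3 x
      exact (s y).1.2
    · refine hV (eq_top_iff.2 fun x _ => ?_)
      obtain ⟨y, rfl⟩ := h3 x
      rw [h2]
      exact (s y).2.2
  obtain ⟨N, hN, -⟩ := (eq_top_or_exists_le_coatom (⊥ : Submodule A P)).resolve_left bot_ne_top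
  refine ⟨P, hproj, N, hN.1, fun U hU => ?_⟩
  by_contra h
  exact hsup U N hU hN.1 (hN.2 _ (right_lt_sup.2 h))

end Rings

/-! ### An injective cogenerating module -/

section Coinduced

variable (k : Type u) (A : Type v) [Field k] [Ring A] [Algebra k A]

/-- The left `A`-module coinduced from the vector space `A`. -/
def Coinduced : Type v := A →ₗ[k] A

noncomputable instance : AddCommGroup (Coinduced k A) := inferInstanceAs (AddCommGroup (A →ₗ[k] A))

noncomputable instance : Module k (Coinduced k A) := inferInstanceAs (Module k (A →ₗ[k] A))

noncomputable instance [FiniteDimensional k A] : FiniteDimensional k (Coinduced k A) :=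
  inferInstanceAs (FiniteDimensional k (A →ₗ[k] A))

variable {k A} in
/-- Elements of the coinduced module as linear maps. -/
noncomputable def Coinduced.toLinearMap : Coinduced k A ≃ₗ[k] (A →ₗ[k] A) := LinearEquiv.refl k _

noncomputable instance : Module A (Coinduced k A) where
  smul a f := Coinduced.toLinearMap.symm (Coinduced.toLinearMap f ∘ₗ LinearMap.mulRight k a)
  one_smul f := LinearMap.ext fun x => congrArg (Coinduced.toLinearMap f) (mul_one x)
  mul_smul a b f := LinearMap.ext fun x =>
    congrArg (Coinduced.toLinearMap f) (mul_assoc x a b).symm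
  smul_zero _ := rfl
  smul_add _ _ _ := rfl
  add_smul a b f := LinearMap.ext fun x =>
    (congrArg (Coinduced.toLinearMap f) (mul_add x a b)).trans (map_add _ _ _)
  zero_smul f := LinearMap.ext fun x =>
    (congrArg (Coinduced.toLinearMap f) (mul_zero x)).trans (map_zero _)

variable {k A}

theorem Coinduced.smul_apply (a : A) (f : Coinduced k A) (x : A) :
    (a • f).toLinearMap x = f.toLinearMap (x * a) := rfl

@[ext]
theorem Coinduced.ext {f g : Coinduced k A} (h : ∀ x, f.toLinearMap x = g.toLinearMap x) : f = g :=
  LinearMap.ext h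

instance : IsScalarTower k A (Coinduced k A) where
  smul_assoc c a f := by
    refine LinearMap.ext fun x => ?_
    change f.toLinearMap (x * (c • a)) = c • f.toLinearMap (x * a)
    rw [mul_smul_comm]
    exact f.toLinearMap.map_smul c _

/-- The `A`-linear map to the coinduced module given by a linear map. -/
noncomputable def Coinduced.lift {X : Type*} [AddCommGroup X] [Module A X] [Module k X]
    [IsScalarTower k A X] (φ : X →ₗ[k] A) : X →ₗ[A] Coinduced k A where
  toFun x := Coinduced.toLinearMap.symm
    (φ ∘ₗ (LinearMap.toSpanSingleton A X x).restrictScalars k)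
  map_add' x y := by
    ext t
    exact (congrArg φ (smul_add t x y)).trans (map_add _ _ _)
  map_smul' a x := by
    ext t
    exact congrArg φ (mul_smul t a x).symm

theorem Coinduced.lift_apply {X : Type*} [AddCommGroup X] [Module A X] [Module k X]
    [IsScalarTower k A X] (φ : X →ₗ[k] A) (x : X) (t : A) :
    (Coinduced.lift φ x).toLinearMap t = φ (t • x) := rfl

/-- Evaluation at `1` turns `A`-linear maps into the coinduced module into `k`-linear maps to `A`,
which extend along injections over a field. -/
instance : Module.Injective A (Coinduced k A) where
  out X Y _ _ _ _ i hi g := by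
    let _ : Module k X := Module.compHom X (algebraMap k A)
    let _ : Module k Y := Module.compHom Y (algebraMap k A)
    have : IsScalarTower k A X := ⟨fun c a x => by
      rw [Algebra.smul_def, mul_smul]; rfl⟩
    have : IsScalarTower k A Y := ⟨fun c a x => by
      rw [Algebra.smul_def, mul_smul]; rfl⟩
    obtain ⟨r, hr⟩ := (i.restrictScalars k).exists_leftInverse_of_injective
      (LinearMap.ker_eq_bot.2 hi)
    let φ : X →ₗ[k] A := {
      toFun := fun x => (g x).toLinearMap 1
      map_add' := fun x y => by rw [map_add, map_add, LinearMap.add_apply]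
      map_smul' := fun c x => by
        rw [← algebraMap_smul A c x, map_smul, algebraMap_smul, map_smul]; rfl }
    refine ⟨Coinduced.lift (φ ∘ₗ r), fun x => ?_⟩
    ext t
    have h1 : r (i (t • x)) = t • x := LinearMap.congr_fun hr _
    rw [Coinduced.lift_apply, LinearMap.comp_apply, ← map_smul, h1]
    change (g (t • x)).toLinearMap 1 = _
    rw [map_smul, Coinduced.smul_apply, one_mul]

/-- Over a finite-dimensional algebra, there is a nonzero morphism from a projective module to an
injective module which annihilates all proper submodules. -/
theorem exists_projective_injective_hom (k : Type u) (A : Type v) [Field k] [Ring A] [Algebra k A]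
    [FiniteDimensional k A] [Nontrivial A] [IsArtinianRing A] :
    ∃ P : Submodule A A, Module.Projective A P ∧ ∃ w : P →ₗ[A] Coinduced k A, w ≠ 0 ∧
      ∀ U : Submodule A P, U ≠ ⊤ → U ≤ LinearMap.ker w := by
  obtain ⟨P, hP, N, hN, hmax⟩ := exists_local_projective A
  obtain ⟨p, hp⟩ : ∃ p, p ∉ N := by
    by_contra! h
    exact hN (eq_top_iff.2 fun x _ => h x)
  have hp' : (N.mkQ p) ≠ 0 := fun h => hp ((Submodule.Quotient.mk_eq_zero N).1 h)
  obtain ⟨f, hf⟩ : ∃ f : Module.Dual k (P ⧸ N), f (N.mkQ p) ≠ 0 := by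
    by_contra! h
    exact hp' ((Module.forall_dual_apply_eq_zero_iff k _).1 h)
  -- The functional is taken with values in `A` instead of `k`, which keeps the injective module in
  -- the universe of `A`.
  let φ : (P ⧸ N) →ₗ[k] A := (Algebra.linearMap k A) ∘ₗ f
  refine ⟨P, hP, Coinduced.lift φ ∘ₗ N.mkQ, fun h => hf ?_, fun U hU x hx => ?_⟩
  · have h1 := congrArg (fun t => Coinduced.toLinearMap t 1) (LinearMap.congr_fun h p)
    simp only [LinearMap.comp_apply, Coinduced.lift_apply, one_smul] at h1
    refine (algebraMap k A).injective ?_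
    rw [map_zero]
    exact h1
  · rw [LinearMap.mem_ker, LinearMap.comp_apply, Submodule.mkQ_apply,
      (Submodule.Quotient.mk_eq_zero N).2 (hmax U hU hx), map_zero]

end Coinduced

/-! ### The category of finitely generated modules -/

section FGModuleCat

variable {A : Type v} [Ring A]

theorem FGModuleCat.isZero_iff [IsNoetherianRing A] (X : FGModuleCat.{v} A) :
    IsZero X ↔ Subsingleton X := by
  rw [IsZero.iff_id_eq_zero]
  refine ⟨fun h => ⟨fun x y => ?_⟩, fun h => FGModuleCat.hom_ext (LinearMap.ext fun x => ?_)⟩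
  · have h1 (z : X) : z = 0 := LinearMap.congr_fun (congrArg (fun f => f.hom.hom) h) z
    rw [h1 x, h1 y]
  · exact Subsingleton.elim _ _

theorem FGModuleCat.epi_iff [IsNoetherianRing A] {X Y : FGModuleCat.{v} A} (f : X ⟶ Y) :
    Epi f ↔ Function.Surjective f.hom.hom := by
  rw [← Functor.epi_map_iff_epi (forget₂ (FGModuleCat.{v} A) (ModuleCat.{v} A)),
    ModuleCat.epi_iff_surjective]
  rfl

theorem FGModuleCat.mono_iff [IsNoetherianRing A] {X Y : FGModuleCat.{v} A} (f : X ⟶ Y) :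
    Mono f ↔ Function.Injective f.hom.hom := by
  rw [← Functor.mono_map_iff_mono (forget₂ (FGModuleCat.{v} A) (ModuleCat.{v} A)),
    ModuleCat.mono_iff_injective]
  rfl

theorem FGModuleCat.projective [IsNoetherianRing A] (X : FGModuleCat.{v} A)
    [Module.Projective A X] : Projective X where
  factors f e he := by
    obtain ⟨h, hh⟩ := Module.projective_lifting_property e.hom.hom f.hom.hom
      ((FGModuleCat.epi_iff e).1 he)
    exact ⟨FGModuleCat.ofHom h, FGModuleCat.hom_ext hh⟩

theorem FGModuleCat.injective [IsNoetherianRing A] (X : FGModuleCat.{v} A)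
    [Module.Injective A X] : Injective X where
  factors g f hf := by
    obtain ⟨h, hh⟩ := Module.Injective.out f.hom.hom ((FGModuleCat.mono_iff f).1 hf) g.hom.hom
    exact ⟨FGModuleCat.ofHom h, FGModuleCat.hom_ext (LinearMap.ext hh)⟩

theorem FGModuleCat.exists_hom_of_not_isZero [IsNoetherianRing A] (N : FGModuleCat.{v} A)
    (hN : ¬ IsZero N) : ∃ f : FGModuleCat.of A A ⟶ N, f ≠ 0 := by
  rw [FGModuleCat.isZero_iff, not_subsingleton_iff_nontrivial] at hN
  obtain ⟨x, hx⟩ := exists_ne (0 : N)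
  refine ⟨FGModuleCat.ofHom (LinearMap.toSpanSingleton A N x), fun h => hx ?_⟩
  have := LinearMap.congr_fun (congrArg (fun f => f.hom.hom) h) (1 : A)
  exact (one_smul A x).symm.trans this

/-- The underlying module of a binary biproduct. -/
noncomputable def FGModuleCat.biprodEquiv [IsNoetherianRing A] (X Y : FGModuleCat.{v} A) :
    (X ⊞ Y : FGModuleCat.{v} A) ≃ₗ[A] X × Y :=
  LinearEquiv.ofLinearMap
    ((biprod.fst : X ⊞ Y ⟶ X).hom.hom.prod (biprod.snd : X ⊞ Y ⟶ Y).hom.hom)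
    ((biprod.inl : X ⟶ X ⊞ Y).hom.hom.coprod (biprod.inr : Y ⟶ X ⊞ Y).hom.hom)
    (by
      have h1 := congrArg (fun f => f.hom.hom) (biprod.inl_fst (X := X) (Y := Y))
      have h2 := congrArg (fun f => f.hom.hom) (biprod.inl_snd (X := X) (Y := Y))
      have h3 := congrArg (fun f => f.hom.hom) (biprod.inr_fst (X := X) (Y := Y))
      have h4 := congrArg (fun f => f.hom.hom) (biprod.inr_snd (X := X) (Y := Y))
      refine LinearMap.ext fun ⟨x, y⟩ => Prod.ext ?_ ?_
      · refine (map_add (biprod.fst : X ⊞ Y ⟶ X).hom.hom _ _).trans ?_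
        refine (congrArg₂ (· + ·) (LinearMap.congr_fun h1 x) (LinearMap.congr_fun h3 y)).trans ?_
        exact add_zero x
      · refine (map_add (biprod.snd : X ⊞ Y ⟶ Y).hom.hom _ _).trans ?_
        refine (congrArg₂ (· + ·) (LinearMap.congr_fun h2 x) (LinearMap.congr_fun h4 y)).trans ?_
        exact zero_add y)
    (LinearMap.ext fun x => LinearMap.congr_fun
      (congrArg (fun f => f.hom.hom) (biprod.total (X := X) (Y := Y))) x)

theorem FGModuleCat.length_toNat_pos [IsNoetherianRing A] [IsArtinianRing A]
    (X : FGModuleCat.{v} A) (hX : ¬ IsZero X) : 0 < (Module.length A X).toNat := by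
  rw [FGModuleCat.isZero_iff, not_subsingleton_iff_nontrivial] at hX
  exact Nat.pos_of_ne_zero fun h => ((ENat.toNat_eq_zero.1 h).elim Module.length_pos.ne'
    Module.length_ne_top)

theorem FGModuleCat.length_toNat_biprod [IsNoetherianRing A] [IsArtinianRing A]
    {X Y Z : FGModuleCat.{v} A} (e : X ≅ Y ⊞ Z) :
    (Module.length A X).toNat = (Module.length A Y).toNat + (Module.length A Z).toNat := by
  rw [((FGModuleCat.isoToLinearEquiv e).trans (FGModuleCat.biprodEquiv Y Z)).length_eq,
    Module.length_prod, ENat.toNat_add Module.length_ne_top Module.length_ne_top]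

/-- An indecomposable finite-dimensional algebra is simple if it has an injective module to which all
nonzero morphisms of finitely generated modules are retractions. -/
theorem isSimpleRing_of_isSplitSink_fgModuleCat {k : Type u} [Field k] [Algebra k A]
    [IsNoetherianRing A] [IsArtinianRing A] (hA : IsIndecomposableAlgebra k A)
    {M : FGModuleCat.{v} A} (h : IsSplitSink M) (hM : Injective M) : IsSimpleRing A := by
  have hnt : Nontrivial M := by
    rw [← not_subsingleton_iff_nontrivial, ← FGModuleCat.isZero_iff]
    exact h.1
  have hsimple : IsSimpleModule A M := by
    rw [isSimpleModule_iff_toSpanSingleton_surjective]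
    refine ⟨hnt, fun m hm => ?_⟩
    have := h.2 _ (FGModuleCat.ofHom (LinearMap.toSpanSingleton A M m)) fun h0 => hm <|
      (one_smul A m).symm.trans
        (LinearMap.congr_fun (congrArg (fun f => f.hom.hom) h0) (1 : A))
    exact (FGModuleCat.epi_iff (FGModuleCat.ofHom (LinearMap.toSpanSingleton A M m))).1
      inferInstance
  have hproj : Module.Projective A M := by
    obtain ⟨f, hf⟩ := FGModuleCat.exists_hom_of_not_isZero M h.1
    have := h.2 _ f hf
    exact Module.Projective.of_split (section_ f).hom.hom f.hom.hom
      (congrArg (fun f => f.hom.hom) (IsSplitEpi.id f))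
  refine isSimpleRing_of_simple_projective_injective hA M fun I g => ?_
  have hmono : Mono (FGModuleCat.ofHom I.subtype) := (FGModuleCat.mono_iff _).2 I.subtype_injective
  obtain ⟨f, hf⟩ := hM.factors (FGModuleCat.ofHom g) (FGModuleCat.ofHom I.subtype)
  exact ⟨f.hom.hom, fun x hx => LinearMap.congr_fun (congrArg (fun f => f.hom.hom) hf) ⟨x, hx⟩⟩

/-- The finitely generated modules over a simple finite-dimensional algebra are projective and
injective, and the nonzero ones receive a nonzero morphism from a fixed simple module. -/
theorem exists_simple_of_isSimpleRing (k : Type u) [Field k] [Algebra k A] [FiniteDimensional k A]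
    [IsNoetherianRing A] [IsSimpleRing A] :
    (∀ X : FGModuleCat.{v} A, Projective X) ∧ (∀ X : FGModuleCat.{v} A, Injective X) ∧
      ∃ S : FGModuleCat.{v} A, Simple S ∧
        ∀ N : FGModuleCat.{v} A, ¬ IsZero N → ∃ f : S ⟶ N, f ≠ 0 := by
  have := IsArtinianRing.of_finite k A
  have : IsSemisimpleRing A := (isSimpleRing_isArtinianRing_iff.1 ⟨inferInstance, inferInstance⟩).1
  have hp (X : Type v) [AddCommGroup X] [Module A X] := Module.projective_of_isSemisimpleRing A X
  have hi (X : Type v) [AddCommGroup X] [Module A X] := Module.injective_of_isSemisimpleRing A X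
  refine ⟨fun X => FGModuleCat.projective X, fun X => FGModuleCat.injective X, ?_⟩
  obtain ⟨S, hS⟩ := IsSemisimpleModule.exists_simple_submodule A A
  refine ⟨FGModuleCat.of A S, ⟨fun {Y} f hf => ⟨?_, fun h0 => ?_⟩⟩, fun N hN => ?_⟩
  · rintro hiso rfl
    have := IsSimpleModule.nontrivial A S
    have h1 : Epi (0 : Y ⟶ FGModuleCat.of A S) := inferInstance
    have h2 := (FGModuleCat.epi_iff _).1 h1
    obtain ⟨s, hs⟩ := exists_ne (0 : S)
    obtain ⟨y, hy⟩ := h2 s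
    exact hs hy.symm
  · have h1 : Function.Surjective f.hom.hom :=
      (LinearMap.surjective_or_eq_zero f.hom.hom).resolve_right
        fun h => h0 (FGModuleCat.hom_ext h)
    have := (FGModuleCat.epi_iff f).2 h1
    exact isIso_of_mono_of_epi f
  · rw [FGModuleCat.isZero_iff, not_subsingleton_iff_nontrivial] at hN
    obtain ⟨m, hm⟩ := IsSemisimpleModule.exists_simple_submodule A N
    -- A simple submodule of `N` is isomorphic to a left ideal, and all simple left ideals of a
    -- simple Artinian ring are isomorphic.
    obtain ⟨I, ⟨e⟩⟩ := IsSemisimpleRing.exists_linearEquiv_ideal_of_isSimpleModule A m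
    have hI : IsSimpleModule A I := IsSimpleModule.congr e.symm
    obtain ⟨e'⟩ := IsSimpleRing.isIsotypic A A S I
    refine ⟨FGModuleCat.ofHom (m.subtype ∘ₗ e.symm.toLinearMap ∘ₗ e'.symm.toLinearMap),
      fun h => ?_⟩
    have := IsSimpleModule.nontrivial A S
    obtain ⟨s, hs⟩ := exists_ne (0 : S)
    have h1 : m.subtype (e.symm (e'.symm s)) = 0 :=
      LinearMap.congr_fun (congrArg (fun f => f.hom.hom) h) s
    simp at h1
    exact hs h1

end FGModuleCat

theorem exists_componentOf_eq {A : Type v} [Ring A] {k : Type u} [Field k] [Algebra k A]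
    [IsNoetherianRing A] [HasDerivedCategory.{w} (FGModuleCat.{v} A)]
    (Λ : ARComponent k (DerivedCategory.Bounded (FGModuleCat.{v} A))) :
    ∃ X hX, componentOf k X hX = Λ := by
  obtain ⟨⟨⟨X, hX⟩⟩⟩ := Λ
  exact ⟨X, hX, rfl⟩

/-! ### Simplicity of the algebra from its derived category -/

section Bounded

variable {k : Type u} [Field k] {A : Type v} [Ring A] [Algebra k A] [FiniteDimensional k A]
  [IsNoetherianRing A] [HasDerivedCategory.{w} (FGModuleCat.{v} A)]

theorem isSimpleRing_of_isSplitSink (hA : IsIndecomposableAlgebra k A)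
    {Z : DerivedCategory.Bounded (FGModuleCat.{v} A)} (hZ : IsSplitSink Z) : IsSimpleRing A := by
  have := IsArtinianRing.of_finite k A
  have := FGModuleCat.projective (FGModuleCat.of A A)
  obtain ⟨M, hM, hM'⟩ := hZ.exists_of_generator (FGModuleCat.of A A)
    FGModuleCat.exists_hom_of_not_isZero
  exact isSimpleRing_of_isSplitSink_fgModuleCat hA hM hM'

/-- The quiver only controls indecomposable sources, whereas `Y` is arbitrary; decomposing it gives
`rad(Y, Z) ⊆ rad²(Y, Z)`, so `v = 0`. -/
theorem isSimpleRing_of_isA1 (hA : IsIndecomposableAlgebra k A)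
    {Y Z : DerivedCategory.Bounded (FGModuleCat.{v} A)} {v : Y ⟶ Z} (hv : IsRightAlmostSplit v)
    (hZ : Indecomposable Z) (h : (componentOf k Z hZ).IsA1) : IsSimpleRing A := by
  have := IsArtinianRing.of_finite k A
  refine isSimpleRing_of_isSplitSink hA (hv.isSplitSink hZ.1 (hv.eq_zero k hZ ?_))
  refine bounded_induction (fun X => (Module.length A X).toNat) FGModuleCat.length_toNat_pos
    (fun _ _ _ => FGModuleCat.length_toNat_biprod)
    (fun X => radical k X Z ≤ radicalSq k X Z) (fun X hX f _ => ?_)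
    (fun X hX => h.radical_le_radicalSq hX hZ rfl)
    (fun X Y W e => radical_le_radicalSq_of_biprod k e) Y
  rw [hX.eq_of_src f 0]
  exact zero_mem _

end Bounded

/-- Over a finite-dimensional algebra, some indecomposable object is the target of a right almost
split morphism. -/
theorem exists_indecomposable_isRightAlmostSplit (k : Type u) [Field k] (A : Type v) [Ring A]
    [Algebra k A] [FiniteDimensional k A] [Nontrivial A] [IsNoetherianRing A]
    [HasDerivedCategory.{w} (FGModuleCat.{v} A)] :
    ∃ (Y Z : DerivedCategory.Bounded (FGModuleCat.{v} A)) (v : Y ⟶ Z),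
      Indecomposable Z ∧ IsRightAlmostSplit v := by
  have := IsArtinianRing.of_finite k A
  obtain ⟨P, hP, w, hw, h⟩ := exists_projective_injective_hom k A
  have : Module.Finite A (Coinduced k A) := Module.Finite.of_restrictScalars_finite k A _
  have := FGModuleCat.projective (FGModuleCat.of A P)
  have := FGModuleCat.injective (FGModuleCat.of A (Coinduced k A))
  obtain ⟨h1, Y, v, hv⟩ := exists_isRightAlmostSplit (FGModuleCat.ofHom w)
    (fun h0 => hw (congrArg (fun f => f.hom.hom) h0)) fun N g hg => by
      rw [FGModuleCat.epi_iff, ← LinearMap.range_eq_top] at hg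
      exact FGModuleCat.hom_ext (LinearMap.ext fun x => h _ hg ⟨x, rfl⟩)
  exact ⟨Y, _, v, h1, hv⟩

end ARTheory

/-- Here `D^b(A)` is the bounded derived category of the abelian category of finitely generated
(equivalently, finite-dimensional) left `A`-modules. -/
theorem mainTheorem6 {k : Type u} [Field k] [IsAlgClosed k]
    (A : Type v) [Ring A] [Algebra k A] [FiniteDimensional k A]
    (hA : ARTheory.IsIndecomposableAlgebra k A) :
    haveI : IsNoetherianRing A := IsNoetherianRing.of_finite k A
    ∀ [HasDerivedCategory.{w} (FGModuleCat.{v} A)],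
    List.TFAE [
      ∃ Λ : ARTheory.ARComponent k (DerivedCategory.Bounded (FGModuleCat.{v} A)),
        Λ.IsStable ∧ Λ.IsA1,
      ∃ D : Triangle (DerivedCategory.Bounded (FGModuleCat.{v} A)),
        ARTheory.IsAuslanderReitenTriangle D ∧ IsZero D.obj₂,
      IsSimpleRing A,
      (∀ Λ : ARTheory.ARComponent k (DerivedCategory.Bounded (FGModuleCat.{v} A)), Λ.IsA1) ∧
        Infinite (ARTheory.ARComponent k (DerivedCategory.Bounded (FGModuleCat.{v} A)))] := by
  have hN : IsNoetherianRing A := IsNoetherianRing.of_finite k A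
  intro _
  have := hA.1
  tfae_have 1 → 3 := by
    rintro ⟨Λ, hs, h⟩
    obtain ⟨X, hX, hXΛ⟩ := ARTheory.exists_componentOf_eq Λ
    obtain ⟨D, hD, ⟨e⟩⟩ := (hs X hX hXΛ).2
    refine ARTheory.isSimpleRing_of_isA1 (k := k) hA hD.isRightAlmostSplit hD.indecomposable₃ ?_
    have h1 : ARTheory.componentOf k D.obj₃ hD.indecomposable₃ = ARTheory.componentOf k X hX :=
      congrArg Quiver.WeaklyConnectedComponent.mk
        (Quotient.sound (s := ARTheory.indecomposableSetoid _) ⟨e⟩)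
    rwa [h1, hXΛ]
  tfae_have 2 → 3 := by
    rintro ⟨D, hD, h⟩
    exact ARTheory.isSimpleRing_of_isSplitSink hA
      (hD.isRightAlmostSplit.isSplitSink hD.indecomposable₃.1 (h.eq_of_src _ _))
  tfae_have 4 → 3 := by
    rintro ⟨h, -⟩
    -- Condition 4 supplies no Auslander-Reiten triangle, so a right almost split morphism is
    -- constructed.
    obtain ⟨Y, Z, v, hZ, hv⟩ := ARTheory.exists_indecomposable_isRightAlmostSplit k A
    exact ARTheory.isSimpleRing_of_isA1 hA hv hZ (h _)
  tfae_have 3 → 4 := by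
    intro h
    obtain ⟨_, _, S, _, hS⟩ := ARTheory.exists_simple_of_isSimpleRing (A := A) k
    exact ⟨ARTheory.ARComponent.isA1 (ARTheory.ARQuiver.isEmpty_hom_of_simple k hS),
      ARTheory.infinite_arComponent_of_simple k hS⟩
  tfae_have 3 → 1 := by
    intro h
    obtain ⟨_, _, S, _, hS⟩ := ARTheory.exists_simple_of_isSimpleRing (A := A) k
    have hinf := ARTheory.infinite_arComponent_of_simple k hS
    obtain ⟨Λ⟩ := hinf.nonempty
    exact ⟨Λ, ARTheory.isStable_of_simple k hS Λ,
      ARTheory.ARComponent.isA1 (ARTheory.ARQuiver.isEmpty_hom_of_simple k hS) Λ⟩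
  tfae_have 3 → 2 := by
    intro h
    obtain ⟨_, _, S, _, hS⟩ := ARTheory.exists_simple_of_isSimpleRing (A := A) k
    have hsink := ARTheory.isSplitSink_boundedSingle_of_simple S 0
    obtain ⟨D, hD, h2, -⟩ := hsink.exists_isAuslanderReitenTriangle (hsink.shift 1) (Iso.refl _)
    exact ⟨D, hD, h2⟩
  tfae_finish
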